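/- Let $X$ be a connected smooth projective complex variety of dimension $n+1$ with $n\ge 1$, let $L$ be an invertible sheaf on $X$, let $D\ge 1$ be an integer, and let $G\subset H^0(X,L^{D})$ be a linear subspace of dimension $n+2$. Let $\mathcal G\subset\mathcal O_X$ be the ideal sheaf generated by $G$ (locally, by the functions that represent the elements of $G$ in a trivialization of $L$), and let $\Sigma\subset X$ be the closed subscheme with $\mathcal O_\Sigma=\mathcal O_X/\mathcal G$. For $m\in\mathbb Z$ let $\mathcal K(G)_m^{\bullet}$ be the Koszul complex of sheaves $$\mathcal O_X(L^{m-(n+2)D})\otimes_{\mathbb C}\Lambda^{n+2}G\to\cdots\to \mathcal O_X(L^{m-D})\otimes_{\mathbb C} G\to \mathcal O_X(L^m),$$ $$s\otimes g_0\wedge\dots\wedge g_j\mapsto\sum_{i}(-1)^i\,(g_is)\otimes g_0\wedge\dots\wedge\widehat{g_i}\wedge\dots\wedge g_j,$$ whose first term is placed in degree $0$ and whose last term is in degree $n+2$. Suppose that $\Sigma$ is artinian and locally a complete intersection in $X$, i.e. at every point $P$ of $\Sigma$ the ideal $\mathcal G_P\subset\mathcal O_{X,P}$ is generated by a regular sequence.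 Then for every $m\in\mathbb Z$ the hypercohomology $\mathbb H^i(X,\mathcal K(G)_m^{\bullet})$ vanishes for all $i\ne n+1,n+2$, and there are isomorphisms of complex vector spaces $$\mathbb H^{n+2}(X,\mathcal K(G)_m^{\bullet})\simeq\mathbb H^{n+1}(X,\mathcal K(G)_m^{\bullet})\simeq\bigoplus_{P\in|\Sigma|}\mathcal O_{\Sigma,P}.$$ -/

import Mathlib

open CategoryTheory AlgebraicGeometry TopologicalSpace Opposite
open scoped TensorProduct

namespace KoszulHyper

/-! ### Schemes over the complex numbers -/

/-- The base scheme `Spec ℂ`. -/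
noncomputable abbrev SpecC : Scheme.{0} := Spec (CommRingCat.of ℂ)

section Base

variable (X : Scheme.{0}) [X.Over SpecC]

/-- The structure map `ℂ → Γ(X, U)`. -/
noncomputable def constMap (U : X.Opens) : ℂ →+* Γ(X, U) :=
  ((Scheme.ΓSpecIso (CommRingCat.of ℂ)).inv ≫ (X ↘ SpecC).appTop ≫
    X.presheaf.map (homOfLE (le_top : U ≤ ⊤)).op).hom

noncomputable instance algebraSections (U : X.Opens) : Algebra ℂ Γ(X, U) :=
  (constMap X U).toAlgebra

noncomputable instance algebraStalk (x : X) : Algebra ℂ (X.presheaf.stalk x) :=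
  ((X.presheaf.germ ⊤ x trivial).hom.comp (constMap X ⊤)).toAlgebra

variable {X}

lemma res_algebraMap {U V : X.Opens} (h : V ≤ U) (c : ℂ) :
    X.presheaf.map (homOfLE h).op (algebraMap ℂ Γ(X, U) c) = algebraMap ℂ Γ(X, V) c := by
  change ((Scheme.ΓSpecIso (CommRingCat.of ℂ)).inv ≫ (X ↘ SpecC).appTop ≫
    X.presheaf.map (homOfLE (le_top : U ≤ ⊤)).op ≫ X.presheaf.map (homOfLE h).op).hom c =
    ((Scheme.ΓSpecIso (CommRingCat.of ℂ)).inv ≫ (X ↘ SpecC).appTop ≫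
    X.presheaf.map (homOfLE (le_top : V ≤ ⊤)).op).hom c
  rw [← X.presheaf.map_comp]
  rfl

lemma res_smul {U V : X.Opens} (h : V ≤ U) (c : ℂ) (r : Γ(X, U)) :
    X.presheaf.map (homOfLE h).op (c • r) = c • X.presheaf.map (homOfLE h).op r := by
  rw [Algebra.smul_def, Algebra.smul_def, map_mul, res_algebraMap]

end Base

/-- The projective space `ℙ^N` over `ℂ`. -/
noncomputable def ProjSpace (N : ℕ) : Scheme.{0} :=
  letI := MvPolynomial.gradedAlgebra (σ := Fin (N + 1)) (R := ℂ)
  Proj (MvPolynomial.homogeneousSubmodule (Fin (N + 1)) ℂ)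

/-- The structure morphism `ℙ^N → Spec ℂ`. -/
noncomputable def ProjSpace.toSpecC (N : ℕ) : ProjSpace N ⟶ SpecC :=
  letI := MvPolynomial.gradedAlgebra (σ := Fin (N + 1)) (R := ℂ)
  Proj.toSpecZero (MvPolynomial.homogeneousSubmodule (Fin (N + 1)) ℂ) ≫
    Spec.map (CommRingCat.ofHom
      (algebraMap ℂ (MvPolynomial.homogeneousSubmodule (Fin (N + 1)) ℂ 0)))

/-- `X` is projective over `ℂ`: it is a closed subscheme of some `ℙ^N`. -/
def IsProjective (X : Scheme.{0}) [X.Over SpecC] : Prop :=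
  ∃ (N : ℕ) (i : X ⟶ ProjSpace N),
    IsClosedImmersion i ∧ i ≫ ProjSpace.toSpecC N = (X ↘ SpecC)

/-! ### Gluing of functions -/

section Gluing

variable {X : Scheme.{0}}

lemma res_res {U V W : X.Opens} (h : V ≤ U) (h' : W ≤ V) (r : Γ(X, U)) :
    X.presheaf.map (homOfLE h').op (X.presheaf.map (homOfLE h).op r) =
      X.presheaf.map (homOfLE (h'.trans h)).op r :=
  (ConcreteCategory.congr_hom
    (X.presheaf.map_comp (homOfLE h).op (homOfLE h').op) r).symm

lemma exists_glue {ι : Type} (U : ι → X.Opens) (V : X.Opens) (hU : ∀ i, U i ≤ V)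
    (hV : V ≤ iSup U) (s : ∀ i, Γ(X, U i))
    (hs : ∀ i j, X.presheaf.map (homOfLE (inf_le_left : U i ⊓ U j ≤ U i)).op (s i) =
      X.presheaf.map (homOfLE (inf_le_right : U i ⊓ U j ≤ U j)).op (s j)) :
    ∃ r : Γ(X, V), ∀ i, X.presheaf.map (homOfLE (hU i)).op r = s i :=
  (X.sheaf.existsUnique_gluing' U V (fun i ↦ homOfLE (hU i)) hV s hs).exists

lemma eq_of_res {ι : Type} (U : ι → X.Opens) (V : X.Opens) (hU : ∀ i, U i ≤ V)
    (hV : V ≤ iSup U) (r r' : Γ(X, V))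
    (h : ∀ i, X.presheaf.map (homOfLE (hU i)).op r = X.presheaf.map (homOfLE (hU i)).op r') :
    r = r' :=
  X.sheaf.eq_of_locally_eq' U V (fun i ↦ homOfLE (hU i)) hV r r' h

end Gluing

/-! ### Invertible sheaves and their tensor powers -/

section Invertible

variable {X : Scheme.{0}} (L : X.Modules)

/-- A frame of `L` over `V`: a section `e` of `L` over `V` such that `r ↦ r • e` is an
isomorphism of `𝒪_V` onto `L|_V`. -/
structure Frame (V : X.Opens) where
  val : Γ(L, V)
  bijective : ∀ (W : X.Opens) (h : W ≤ V),
    Function.Bijective fun r : Γ(X, W) ↦ r • L.presheaf.map (homOfLE h).op val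

/-- An invertible sheaf: an `𝒪_X`-module locally isomorphic to `𝒪_X`. -/
def IsInvertible : Prop :=
  ∀ x : X, ∃ V : X.Opens, x ∈ V ∧ Nonempty (Frame L V)

variable {L}

/-- The restriction of a frame to a smaller open subset. -/
noncomputable def Frame.restrict {V W : X.Opens} (h : W ≤ V) (e : Frame L V) : Frame L W where
  val := L.presheaf.map (homOfLE h).op e.val
  bijective W' h' := by
    have := e.bijective W' (h'.trans h)
    convert this using 4
    exact (ConcreteCategory.congr_hom
      (L.presheaf.map_comp (homOfLE h).op (homOfLE h').op) e.val).symm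

/-- The frame `u • e`, for an invertible function `u`. -/
noncomputable def Frame.unitSMul {V : X.Opens} (u : Γ(X, V)ˣ) (e : Frame L V) : Frame L V where
  val := (u : Γ(X, V)) • e.val
  bijective W h := by
    have hu : IsUnit (X.presheaf.map (homOfLE h).op (u : Γ(X, V))) :=
      u.isUnit.map (X.presheaf.map (homOfLE h).op).hom
    have := (e.bijective W h).comp hu.unit.mulRight_bijective
    convert this using 2
    simp [mul_smul]

@[simp]
lemma Frame.restrict_refl {V : X.Opens} (e : Frame L V) : e.restrict le_rfl = e := by
  rcases e with ⟨v, hv⟩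
  simp only [Frame.restrict, Frame.mk.injEq]
  exact ConcreteCategory.congr_hom (L.presheaf.map_id (op V)) v

@[simp]
lemma Frame.restrict_restrict {V W W' : X.Opens} (h : W ≤ V) (h' : W' ≤ W) (e : Frame L V) :
    (e.restrict h).restrict h' = e.restrict (h'.trans h) := by
  simp only [Frame.restrict, Frame.mk.injEq]
  exact (ConcreteCategory.congr_hom
    (L.presheaf.map_comp (homOfLE h).op (homOfLE h').op) e.val).symm

lemma Frame.restrict_unitSMul {V W : X.Opens} (h : W ≤ V) (u : Γ(X, V)ˣ) (e : Frame L V) :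
    (e.unitSMul u).restrict h =
      (e.restrict h).unitSMul (Units.map (X.presheaf.map (homOfLE h).op).hom u) := by
  simp [Frame.restrict, Frame.unitSMul]

variable [X.Over SpecC] (L)

/-- The sections over `U` of the tensor power `L^k`, `k ∈ ℤ`, of an invertible sheaf `L`.
A section `s` of `L^k` is described by its coordinates: for every open `V ⊆ U` and every frame
`e` of `L` over `V`, the function `a V e` with `s|_V = (a V e) • e^{⊗k}`. The coordinates are
compatible with restriction, and the relation `(u • e)^{⊗k} = u^k • e^{⊗k}` gives
`a V (u • e) = u^{-k} * a V e`. -/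
def powSections (k : ℤ) (U : X.Opens) :
    Submodule ℂ (∀ V : {V : X.Opens // V ≤ U}, Frame L V.1 → Γ(X, V.1)) where
  carrier := {a |
    (∀ (V W : {V : X.Opens // V ≤ U}) (h : W.1 ≤ V.1) (e : Frame L V.1),
      a W (e.restrict h) = X.presheaf.map (homOfLE h).op (a V e)) ∧
    (∀ (V : {V : X.Opens // V ≤ U}) (e : Frame L V.1) (u : Γ(X, V.1)ˣ),
      a V (e.unitSMul u) = ((u ^ (-k) : Γ(X, V.1)ˣ) : Γ(X, V.1)) * a V e)}
  zero_mem' := ⟨fun V W h e ↦ by simp, fun V e u ↦ by simp⟩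
  add_mem' {a b} ha hb :=
    ⟨fun V W h e ↦ by simp [ha.1 V W h, hb.1 V W h],
      fun V e u ↦ by simp [ha.2 V e u, hb.2 V e u, mul_add]⟩
  smul_mem' c a ha :=
    ⟨fun V W h e ↦ by
        simp only [Pi.smul_apply]
        rw [ha.1 V W h, res_smul],
      fun V e u ↦ by simp [ha.2 V e u]⟩

/-- The presheaf `U ↦ L^k(U)` of complex vector spaces. -/
noncomputable def powPresheaf (k : ℤ) : TopCat.Presheaf (ModuleCat.{0} ℂ) X.toTopCat where
  obj U := ModuleCat.of ℂ (powSections L k U.unop)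
  map {U U'} f := ModuleCat.ofHom
    { toFun a := ⟨fun V e ↦ a.1 ⟨V.1, V.2.trans f.unop.le⟩ e,
        fun V W h e ↦ a.2.1 ⟨V.1, V.2.trans f.unop.le⟩ ⟨W.1, W.2.trans f.unop.le⟩ h e,
        fun V e u ↦ a.2.2 ⟨V.1, V.2.trans f.unop.le⟩ e u⟩
      map_add' _ _ := rfl
      map_smul' _ _ := rfl }

/-- The product `L^k ⊗ L^l → L^{k+l}`, on sections over `U`. -/
noncomputable def powMul {k l p : ℤ} (h : k + l = p) (U : X.Opens) :
    powSections L k U →ₗ[ℂ] powSections L l U →ₗ[ℂ] powSections L p U :=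
  LinearMap.mk₂ ℂ
    (fun a b ↦ ⟨fun V e ↦ a.1 V e * b.1 V e,
      fun V W h e ↦ by
        beta_reduce
        rw [a.2.1 V W h e, b.2.1 V W h e, map_mul],
      fun V e u ↦ by
        beta_reduce
        rw [a.2.2 V e u, b.2.2 V e u, ← h, neg_add, zpow_add, Units.val_mul]
        ring⟩)
    (fun a a' b ↦ by ext V e; simp [add_mul])
    (fun c a b ↦ by ext V e; simp)
    (fun a b b' ↦ by ext V e; simp [mul_add])
    (fun c a b ↦ by ext V e; simp)

/-- Restriction of a global section of `L^k` to `U`. -/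
noncomputable def powRes (k : ℤ) (U : X.Opens) : powSections L k ⊤ →ₗ[ℂ] powSections L k U :=
  ((powPresheaf L k).map (homOfLE (le_top : U ≤ ⊤)).op).hom


lemma powPresheaf_isSheaf (k : ℤ) : (powPresheaf L k).IsSheaf := by
  rw [TopCat.Presheaf.isSheaf_iff_isSheaf_comp (forget (ModuleCat.{0} ℂ)),
    TopCat.Presheaf.isSheaf_iff_isSheafUniqueGluing_types]
  intro ι U sf hsf
  have hcompat : ∀ (i j : ι) (V : X.Opens) (hi : V ≤ U i) (hj : V ≤ U j) (e : Frame L V),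
      (sf i).1 ⟨V, hi⟩ e = (sf j).1 ⟨V, hj⟩ e := by
    intro i j V hi hj e
    exact congrFun (congrFun (congrArg Subtype.val (hsf i j)) ⟨V, le_inf hi hj⟩) e
  have hcov : ∀ V : X.Opens, V ≤ iSup U → V ≤ ⨆ i, V ⊓ U i := fun V hV ↦ by
    rw [← inf_iSup_eq]
    exact le_inf le_rfl hV
  have key : ∀ (V : {V : X.Opens // V ≤ iSup U}) (e : Frame L V.1), ∃ r : Γ(X, V.1),
      ∀ i, X.presheaf.map (homOfLE (inf_le_left : V.1 ⊓ U i ≤ V.1)).op r =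
        (sf i).1 ⟨V.1 ⊓ U i, inf_le_right⟩ (e.restrict inf_le_left) := by
    intro V e
    refine exists_glue (fun i ↦ V.1 ⊓ U i) V.1 (fun i ↦ inf_le_left) (hcov V.1 V.2)
      (fun i ↦ (sf i).1 ⟨V.1 ⊓ U i, inf_le_right⟩ (e.restrict inf_le_left)) fun i j ↦ ?_
    rw [← (sf i).2.1 ⟨V.1 ⊓ U i, inf_le_right⟩
        ⟨(V.1 ⊓ U i) ⊓ (V.1 ⊓ U j), inf_le_left.trans inf_le_right⟩ inf_le_left,
      ← (sf j).2.1 ⟨V.1 ⊓ U j, inf_le_right⟩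
        ⟨(V.1 ⊓ U i) ⊓ (V.1 ⊓ U j), inf_le_right.trans inf_le_right⟩ inf_le_right,
      Frame.restrict_restrict, Frame.restrict_restrict]
    exact hcompat _ _ _ _ _ _
  choose a ha using key
  have ha' : ∀ (V : {V : X.Opens // V ≤ iSup U}) (e : Frame L V.1) (i : ι) (W : X.Opens)
      (hV : W ≤ V.1) (hW : W ≤ U i), X.presheaf.map (homOfLE hV).op (a V e) =
        (sf i).1 ⟨W, hW⟩ (e.restrict hV) := by
    intro V e i W hV hW
    rw [← res_res (inf_le_left : V.1 ⊓ U i ≤ V.1) (le_inf hV hW), ha,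
      ← (sf i).2.1 ⟨V.1 ⊓ U i, inf_le_right⟩ ⟨W, hW⟩ (le_inf hV hW), Frame.restrict_restrict]
  refine ⟨⟨a, ?_, ?_⟩, ?_, ?_⟩
  · intro V W h e
    refine eq_of_res (fun i ↦ W.1 ⊓ U i) W.1 (fun i ↦ inf_le_left) (hcov _ W.2) _ _ fun i ↦ ?_
    rw [ha' W _ i _ inf_le_left inf_le_right, res_res, ha' V _ i _ (inf_le_left.trans h)
      inf_le_right, Frame.restrict_restrict]
  · intro V e u
    refine eq_of_res (fun i ↦ V.1 ⊓ U i) V.1 (fun i ↦ inf_le_left) (hcov _ V.2) _ _ fun i ↦ ?_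
    rw [map_mul, ha' V _ i _ inf_le_left inf_le_right, ha' V _ i _ inf_le_left inf_le_right,
      Frame.restrict_unitSMul, (sf i).2.2, ← map_zpow]
    rfl
  · intro i
    refine Subtype.ext (funext fun V ↦ funext fun e ↦ ?_)
    have := ha' ⟨V.1, V.2.trans (le_iSup U i)⟩ e i V.1 le_rfl V.2
    rw [Frame.restrict_refl] at this
    rw [← this]
    exact (ConcreteCategory.congr_hom (X.presheaf.map_id (op V.1)) _).symm
  · intro b hb
    refine Subtype.ext (funext fun V ↦ funext fun e ↦ ?_)
    refine eq_of_res (fun i ↦ V.1 ⊓ U i) V.1 (fun i ↦ inf_le_left) (hcov _ V.2) _ _ fun i ↦ ?_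
    rw [ha' V _ i _ inf_le_left inf_le_right, ← hb i]
    exact (b.2.1 V ⟨V.1 ⊓ U i, inf_le_left.trans V.2⟩ inf_le_left e).symm

end Invertible

/-! ### The Koszul complex -/

section Tensor

variable {X : TopCat.{0}}

/-- The sheaf `F ⊗_ℂ V`, with sections `F(U) ⊗_ℂ V` over `U`, for a sheaf `F` of complex vector
spaces and a finite-dimensional space `V`. -/
noncomputable def tensorPresheaf (F : TopCat.Presheaf (ModuleCat.{0} ℂ) X) (V : Type)
    [AddCommGroup V] [Module ℂ V] : TopCat.Presheaf (ModuleCat.{0} ℂ) X where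
  obj U := ModuleCat.of ℂ (F.obj U ⊗[ℂ] V)
  map f := ModuleCat.ofHom ((F.map f).hom.rTensor V)

lemma tensorPresheaf_isSheaf (F : TopCat.Presheaf (ModuleCat.{0} ℂ) X) (hF : F.IsSheaf)
    (V : Type) [AddCommGroup V] [Module ℂ V] [FiniteDimensional ℂ V] :
    (tensorPresheaf F V).IsSheaf := by
  rw [TopCat.Presheaf.isSheaf_iff_isSheaf_comp (forget (ModuleCat.{0} ℂ)),
    TopCat.Presheaf.isSheaf_iff_isSheafUniqueGluing_types] at hF ⊢
  intro ι U sf hsf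
  let b := Module.finBasis ℂ V
  let c (U : (Opens X)ᵒᵖ) : F.obj U ⊗[ℂ] V ≃ₗ[ℂ] (Fin (Module.finrank ℂ V) →₀ F.obj U) :=
    TensorProduct.equivFinsuppOfBasisRight b
  have hc : ∀ {U U' : (Opens X)ᵒᵖ} (f : U ⟶ U') (x : F.obj U ⊗[ℂ] V) (q),
      c U' ((F.map f).hom.rTensor V x) q = F.map f (c U x q) := by
    intro U U' f x q
    induction x with
    | zero => simp
    | add x y hx hy => simp only [map_add, Finsupp.add_apply, hx, hy]
    | tmul x v => simp [c]
  have key : ∀ q, ∃! s : F.obj (op (iSup U)), ∀ i,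
      F.map (homOfLE (le_iSup U i)).op s = c (op (U i)) (sf i) q := by
    intro q
    refine hF U (fun i ↦ c (op (U i)) (sf i) q) fun i j ↦ ?_
    have h1 := hc (homOfLE (inf_le_left : U i ⊓ U j ≤ U i)).op (sf i) q
    have h2 := hc (homOfLE (inf_le_right : U i ⊓ U j ≤ U j)).op (sf j) q
    refine h1.symm.trans (Eq.trans ?_ h2)
    exact congrArg (fun z ↦ c (op (U i ⊓ U j)) z q) (hsf i j)
  choose s hs hs' using key
  refine ⟨(c (op (iSup U))).symm (Finsupp.equivFunOnFinite.symm s), fun i ↦ ?_, fun t ht ↦ ?_⟩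
  · refine (c (op (U i))).injective (Finsupp.ext fun q ↦ ?_)
    refine (hc (homOfLE (le_iSup U i)).op _ q).trans ?_
    rw [LinearEquiv.apply_symm_apply]
    exact hs q i
  · refine (c (op (iSup U))).injective (Finsupp.ext fun q ↦ ?_)
    rw [LinearEquiv.apply_symm_apply]
    refine hs' q _ fun i ↦ ?_
    refine (hc (homOfLE (le_iSup U i)).op t q).symm.trans ?_
    exact congrArg (fun z ↦ c (op (U i)) z q) (ht i)

end Tensor

section KoszulAlgebra

variable {G : Type} [AddCommGroup G] [Module ℂ G]
  {M N P : Type} [AddCommGroup M] [Module ℂ M] [AddCommGroup N] [Module ℂ N]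
  [AddCommGroup P] [Module ℂ P]

/-- For a bilinear `μ : G × M → N`, the map `s ↦ (g ↦ (x ↦ μ(g, s) ⊗ x))`. -/
noncomputable def koszulAux (μ : G →ₗ[ℂ] M →ₗ[ℂ] N) (j : ℕ) :
    M →ₗ[ℂ] G →ₗ[ℂ] (G [⋀^Fin j]→ₗ[ℂ] (N ⊗[ℂ] ⋀[ℂ]^j G)) :=
  LinearMap.mk₂ ℂ
    (fun s g ↦ (TensorProduct.mk ℂ N (⋀[ℂ]^j G) (μ g s)).compAlternatingMap
      (exteriorPower.ιMulti ℂ j))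
    (fun s s' g ↦ by ext v; simp)
    (fun c s g ↦ by ext v; simp)
    (fun s g g' ↦ by ext v; simp)
    (fun c s g ↦ by ext v; simp)

/-- The Koszul differential `M ⊗ Λ^{j+1} G → N ⊗ Λ^j G` of a bilinear `μ : G × M → N`,
`s ⊗ g_0 ∧ ⋯ ∧ g_j ↦ ∑_i (-1)^i μ(g_i, s) ⊗ g_0 ∧ ⋯ ∧ ĝ_i ∧ ⋯ ∧ g_j`. -/
noncomputable def koszulD (μ : G →ₗ[ℂ] M →ₗ[ℂ] N) (j : ℕ) :
    M ⊗[ℂ] ⋀[ℂ]^(j + 1) G →ₗ[ℂ] N ⊗[ℂ] ⋀[ℂ]^j G :=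
  TensorProduct.lift (exteriorPower.alternatingMapLinearEquiv.toLinearMap ∘ₗ
    AlternatingMap.alternatizeUncurryFinLM ∘ₗ koszulAux μ j)

lemma koszulD_tmul_ιMulti (μ : G →ₗ[ℂ] M →ₗ[ℂ] N) (j : ℕ) (s : M) (v : Fin (j + 1) → G) :
    koszulD μ j (s ⊗ₜ exteriorPower.ιMulti ℂ (j + 1) v) =
      ∑ i : Fin (j + 1), (-1 : ℤ) ^ (i : ℕ) • (μ (v i) s ⊗ₜ[ℂ] exteriorPower.ιMulti ℂ j (i.removeNth v)) := by
  simp [koszulD, koszulAux, AlternatingMap.alternatizeUncurryFin_apply]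

lemma koszulD_comp (μ : G →ₗ[ℂ] M →ₗ[ℂ] N) (ν : G →ₗ[ℂ] N →ₗ[ℂ] P)
    (h : ∀ g g' s, ν g (μ g' s) = ν g' (μ g s)) (j : ℕ) :
    koszulD ν j ∘ₗ koszulD μ (j + 1) = 0 := by
  refine TensorProduct.ext (LinearMap.ext fun s ↦ exteriorPower.linearMap_ext ?_)
  let f : G →ₗ[ℂ] G →ₗ[ℂ] (G [⋀^Fin j]→ₗ[ℂ] (P ⊗[ℂ] ⋀[ℂ]^j G)) := koszulAux ν j ∘ₗ μ.flip s
  have hf := AlternatingMap.alternatizeUncurryFin_alternatizeUncurryFinLM_comp_of_symmetric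
    (f := f) (fun x y ↦ by ext v; simp [f, koszulAux, h x y])
  refine Eq.trans ?_ hf
  ext v
  change koszulD ν j (koszulD μ (j + 1) (s ⊗ₜ exteriorPower.ιMulti ℂ (j + 2) v)) = _
  simp only [AlternatingMap.alternatizeUncurryFin_apply, koszulD_tmul_ιMulti, map_sum, map_zsmul,
    AlternatingMap.alternatizeUncurryFinLM_apply, LinearMap.comp_apply]
  rfl

lemma koszulD_natural {M' N' : Type} [AddCommGroup M'] [Module ℂ M'] [AddCommGroup N']
    [Module ℂ N'] (μ : G →ₗ[ℂ] M →ₗ[ℂ] N) (μ' : G →ₗ[ℂ] M' →ₗ[ℂ] N') (α : M →ₗ[ℂ] M')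
    (β : N →ₗ[ℂ] N') (h : ∀ g s, β (μ g s) = μ' g (α s)) (j : ℕ) :
    β.rTensor _ ∘ₗ koszulD μ j = koszulD μ' j ∘ₗ α.rTensor _ := by
  refine TensorProduct.ext (LinearMap.ext fun s ↦ exteriorPower.linearMap_ext ?_)
  ext v
  change β.rTensor _ (koszulD μ j (s ⊗ₜ exteriorPower.ιMulti ℂ (j + 1) v)) =
    koszulD μ' j (α s ⊗ₜ exteriorPower.ιMulti ℂ (j + 1) v)
  simp only [koszulD_tmul_ιMulti, map_sum, map_zsmul, LinearMap.rTensor_tmul, h]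

end KoszulAlgebra

section KoszulPresheaf

variable {X : TopCat.{0}} {G : Type} [AddCommGroup G] [Module ℂ G]
  {F F' F'' : TopCat.Presheaf (ModuleCat.{0} ℂ) X}

/-- The Koszul differential `F ⊗ Λ^{j+1} G → F' ⊗ Λ^j G` of presheaves, for bilinear maps
`G × F(U) → F'(U)` compatible with restriction. -/
noncomputable def koszulPresheafHom (μ : ∀ U, G →ₗ[ℂ] F.obj U →ₗ[ℂ] F'.obj U)
    (hμ : ∀ {U U'} (f : U ⟶ U') (g : G) (s : F.obj U),
      (F'.map f).hom (μ U g s) = μ U' g ((F.map f).hom s)) (j : ℕ) :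
    tensorPresheaf F (⋀[ℂ]^(j + 1) G) ⟶ tensorPresheaf F' (⋀[ℂ]^j G) where
  app U := ModuleCat.ofHom (koszulD (μ U) j)
  naturality _ _ f := ModuleCat.hom_ext
    (koszulD_natural (μ _) (μ _) (F.map f).hom (F'.map f).hom (hμ f) j).symm

lemma koszulPresheafHom_comp (μ : ∀ U, G →ₗ[ℂ] F.obj U →ₗ[ℂ] F'.obj U) (hμ)
    (ν : ∀ U, G →ₗ[ℂ] F'.obj U →ₗ[ℂ] F''.obj U) (hν)
    (h : ∀ U g g' s, ν U g (μ U g' s) = ν U g' (μ U g s)) (j : ℕ) :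
    koszulPresheafHom μ hμ (j + 1) ≫ koszulPresheafHom ν hν j = 0 :=
  NatTrans.ext (funext fun U ↦ ModuleCat.hom_ext (koszulD_comp (μ U) (ν U) (h U) j))

end KoszulPresheaf

/-- Sheaves of complex vector spaces on `X`. -/
abbrev SheafC (X : Scheme.{0}) :=
  Sheaf (Opens.grothendieckTopology X) (ModuleCat.{0} ℂ)

section Koszul

variable {X : Scheme.{0}} [X.Over SpecC] (L : X.Modules) (D : ℕ)
  (G : Submodule ℂ (powSections L D ⊤))

variable {L D} in
/-- The multiplication `G × L^k(U) → L^{k+D}(U)`. -/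
noncomputable def koszulMul {k l : ℤ} (h : k + D = l) (U : X.Opensᵒᵖ) :
    G →ₗ[ℂ] (powPresheaf L k).obj U →ₗ[ℂ] (powPresheaf L l).obj U :=
  (powMul L h U.unop).flip ∘ₗ powRes L D U.unop ∘ₗ G.subtype

lemma koszulMul_res {k l : ℤ} (h : k + D = l) {U U' : X.Opensᵒᵖ} (f : U ⟶ U') (g : G)
    (s : (powPresheaf L k).obj U) :
    ((powPresheaf L l).map f).hom (koszulMul G h U g s) =
      koszulMul G h U' g (((powPresheaf L k).map f).hom s) :=
  rfl

lemma koszulMul_comm {k l p : ℤ} (h : k + D = l) (h' : l + D = p) (U : X.Opensᵒᵖ) (g g' : G)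
    (s : (powPresheaf L k).obj U) :
    koszulMul G h' U g (koszulMul G h U g' s) = koszulMul G h' U g' (koszulMul G h U g s) := by
  refine Subtype.ext (funext fun V ↦ funext fun e ↦ ?_)
  change s.1 V e * (powRes L D U.unop g'.1).1 V e * (powRes L D U.unop g.1).1 V e =
    s.1 V e * (powRes L D U.unop g.1).1 V e * (powRes L D U.unop g'.1).1 V e
  exact mul_right_comm _ _ _

variable {L D} in
/-- The Koszul differential `L^k ⊗ Λ^{j+1} G → L^{k+D} ⊗ Λ^j G`,
`s ⊗ g_0 ∧ ⋯ ∧ g_j ↦ ∑_i (-1)^i g_i s ⊗ g_0 ∧ ⋯ ∧ ĝ_i ∧ ⋯ ∧ g_j`. -/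
noncomputable def koszulDiffAux {k l : ℤ} (h : k + D = l) (j : ℕ) :
    tensorPresheaf (powPresheaf L k) (⋀[ℂ]^(j + 1) G) ⟶
      tensorPresheaf (powPresheaf L l) (⋀[ℂ]^j G) :=
  koszulPresheafHom (koszulMul G h) (koszulMul_res L D G h) j

lemma koszulDiffAux_comp {k l p : ℤ} (h : k + D = l) (h' : l + D = p) (j : ℕ) :
    koszulDiffAux G h (j + 1) ≫ koszulDiffAux G h' j = 0 :=
  koszulPresheafHom_comp _ _ _ _ (koszulMul_comm L D G h h') j

variable [FiniteDimensional ℂ G] (m : ℤ)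

/-- The sheaf `L^{m - jD} ⊗ Λ^j G`. -/
noncomputable def koszulTerm (j : ℕ) : SheafC X :=
  ⟨tensorPresheaf (powPresheaf L (m - j * D)) (⋀[ℂ]^j G),
    tensorPresheaf_isSheaf _ (powPresheaf_isSheaf L _) _⟩

/-- The Koszul differential `L^{m - (j+1)D} ⊗ Λ^{j+1} G → L^{m - jD} ⊗ Λ^j G`. -/
noncomputable def koszulDiff (j : ℕ) : koszulTerm L D G m (j + 1) ⟶ koszulTerm L D G m j :=
  ⟨koszulDiffAux G (show m - (j + 1 : ℕ) * D + D = m - j * D by push_cast; ring) j⟩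

lemma koszulDiff_comp (j : ℕ) :
    koszulDiff L D G m (j + 1) ≫ koszulDiff L D G m j = 0 :=
  Sheaf.hom_ext (koszulDiffAux_comp L D G _ _ j)

/-- The sheaf Koszul complex `𝒦(G)_m`
`L^{m - rD} ⊗ Λ^r G → ⋯ → L^{m - D} ⊗ G → L^m`, `r = dim G`,
with the term `L^{m - jD} ⊗ Λ^j G` in cohomological degree `r - j`. -/
noncomputable def koszulComplex : CochainComplex (SheafC X) ℤ :=
  (ChainComplex.of (koszulTerm L D G m) (koszulDiff L D G m) (koszulDiff_comp L D G m)).extend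
    (ComplexShape.embeddingUpIntLE (Module.finrank ℂ G))

end Koszul

/-! ### Hypercohomology -/

section Hypercohomology

variable {X : Scheme.{0}}

noncomputable instance hasDerivedCategorySheafC : HasDerivedCategory (SheafC X) :=
  HasDerivedCategory.standard _

/-- The hypercohomology `ℍ^i(X, K) = H^i(RΓ(X, K))`, as the complex vector space of
morphisms from the constant sheaf `ℂ_X` to `K[i]` in the derived category of sheaves of complex
vector spaces on `X`. -/
abbrev Hypercohomology (K : CochainComplex (SheafC X) ℤ) (i : ℤ) : Type 1 :=
  (DerivedCategory.singleFunctor (SheafC X) 0).obj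
    ((constantSheaf (Opens.grothendieckTopology X) (ModuleCat.{0} ℂ)).obj (ModuleCat.of ℂ ℂ)) ⟶
  (DerivedCategory.Q.obj K)⟦i⟧

end Hypercohomology

/-! ### The zero scheme of a space of sections -/

section ZeroScheme

variable {X : Scheme.{0}} [X.Over SpecC] (L : X.Modules) (D : ℕ)
  (G : Submodule ℂ (powSections L D ⊤))

/-- The ideal sheaf generated by `G ⊆ H^0(X, L^D)`: the smallest ideal sheaf which contains the
coordinates of all `g ∈ G` in all local frames of `L`. -/
noncomputable def generatedIdeal : X.IdealSheafData :=
  sInf {J | ∀ g ∈ G, ∀ (V : X.affineOpens) (e : Frame L V.1),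
    g.1 ⟨V.1, le_top⟩ e ∈ J.ideal V}

/-- The closed subscheme of `X` with structure sheaf `𝒪_X / 𝒢`, where `𝒢` is the ideal sheaf
generated by `G`. -/
noncomputable abbrev zeroScheme : Scheme.{0} := (generatedIdeal L D G).subscheme

noncomputable instance : (zeroScheme L D G).Over SpecC :=
  ⟨(generatedIdeal L D G).subschemeι ≫ (X ↘ SpecC)⟩

end ZeroScheme

/-- A closed immersion `i : Z → X` is a local complete intersection if for every `z ∈ Z` the
ideal of `Z` in the local ring `𝒪_{X, i(z)}` is generated by a regular sequence. -/
def IsLocalCompleteIntersection {Z X : Scheme.{0}} (i : Z ⟶ X) : Prop :=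
  ∀ z : Z, ∃ rs : List (X.presheaf.stalk (i z)),
    RingTheory.Sequence.IsRegular (X.presheaf.stalk (i z)) rs ∧
      RingHom.ker (i.stalkMap z).hom = Ideal.ofList rs

end KoszulHyper

/-! A frame of `L` near a point `x` turns the Koszul complex of sheaves, on stalks at `x`, into the
Koszul complex over `R = 𝒪_{X,x}` of the linear map `φ : G → R` of coordinates of sections. The
image of `φ` generates the stalk of the ideal sheaf of `Σ`. Since stalks are exact, the homology
sheaves are governed by commutative algebra.

The ideal generated by `φ` annihilates Koszul homology, because multiplication by `φ g` is homotopic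
to zero through `g ∧ -`. Off `Σ` this ideal is the unit ideal, so the homology vanishes. At a point
`P` of `Σ` the ideal is generated by a regular sequence. The point is closed and `X` is smooth, so
the local ring has dimension `n + 1`; as the quotient is artinian, the sequence has length `n + 1 =
dim G - 1`. Dividing by one regular element `f` of the ideal gives `H_{i+1}(M / fM) ≃ H_i(M)`
wherever `H_{i+1}(M)` vanishes. Iteration shows `H_i = 0` for `i ≥ 2`, and identifies `H_1` with the
top Koszul homology of `R / I`, on which `φ` acts by zero; this is `R / I` tensored with the line
`Λ^{n+2} G`. Also `H_0 = R / I`. These steps are `koszulModExact_of_isWeaklyRegular`,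
`nonempty_koszulModH_equiv_quotient` and `nonempty_koszulModH_zero_equiv`.

Thus only the cohomology sheaves in degrees `n + 1` and `n + 2` survive, and both live on the finite
set `|Σ|` of closed points. Such a sheaf is a finite sum of skyscrapers, hence an injective sheaf of
vector spaces (`injective_of_finite_support`). A complex with injective cohomology in just two
degrees is quasi-isomorphic to the direct sum of its shifted cohomology objects
(`exists_quasiIso_biprod_single`). Injectivity leaves no higher Ext, so each of the two
hypercohomology spaces is the space of global sections of one cohomology sheaf, that is, the sum of
its stalks. -/

namespace KoszulHyper

/-! ### Koszul homology over a ring and regular sequences -/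

section KoszulHomology

open scoped Pointwise

variable {R : Type} [CommRing R] [Algebra ℂ R] {G : Type} [AddCommGroup G] [Module ℂ G]
  (φ : G →ₗ[ℂ] R) (M : Type) [AddCommGroup M] [Module R M] [Module ℂ M] [IsScalarTower ℂ R M]

/-- The action of `G` on an `R`-module through a linear map `φ : G → R`. -/
noncomputable def actionMap : G →ₗ[ℂ] M →ₗ[ℂ] M :=
  (Algebra.lsmul ℂ ℂ M).toLinearMap ∘ₗ φ

@[simp]
lemma actionMap_apply (g : G) (s : M) : actionMap φ M g s = φ g • s := rfl

/-- The differential of the Koszul complex of `φ : G → R` with coefficients in `M`. -/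
noncomputable abbrev koszulModD (j : ℕ) : M ⊗[ℂ] ⋀[ℂ]^(j + 1) G →ₗ[ℂ] M ⊗[ℂ] ⋀[ℂ]^j G :=
  koszulD (actionMap φ M) j

lemma koszulModD_comp_apply (j : ℕ) (z : M ⊗[ℂ] ⋀[ℂ]^(j + 2) G) :
    koszulModD φ M j (koszulModD φ M (j + 1) z) = 0 :=
  LinearMap.congr_fun (koszulD_comp (actionMap φ M) (actionMap φ M)
    (fun g g' s ↦ smul_comm (φ g) (φ g') s) j) z

variable {M} in
lemma koszulModD_rTensor {M' : Type} [AddCommGroup M'] [Module R M'] [Module ℂ M']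
    [IsScalarTower ℂ R M'] (α : M →ₗ[R] M') (j : ℕ) (z : M ⊗[ℂ] ⋀[ℂ]^(j + 1) G) :
    (α.restrictScalars ℂ).rTensor _ (koszulModD φ M j z) =
      koszulModD φ M' j ((α.restrictScalars ℂ).rTensor _ z) :=
  LinearMap.congr_fun (koszulD_natural (actionMap φ M) (actionMap φ M') (α.restrictScalars ℂ)
    (α.restrictScalars ℂ) (fun g s ↦ α.map_smul (φ g) s) j) z

/-- Multiplication by `a : R` on `M ⊗ V`. -/
noncomputable abbrev mulTensor (V : Type) [AddCommGroup V] [Module ℂ V] (a : R) :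
    M ⊗[ℂ] V →ₗ[ℂ] M ⊗[ℂ] V :=
  ((LinearMap.lsmul R M a).restrictScalars ℂ).rTensor V

lemma koszulModD_mulTensor (a : R) (j : ℕ) (z : M ⊗[ℂ] ⋀[ℂ]^(j + 1) G) :
    mulTensor M _ a (koszulModD φ M j z) = koszulModD φ M j (mulTensor M _ a z) :=
  koszulModD_rTensor φ (LinearMap.lsmul R M a) j z

lemma mulTensor_add (V : Type) [AddCommGroup V] [Module ℂ V] (a b : R)
    (z : M ⊗[ℂ] V) :
    mulTensor M V (a + b) z = mulTensor M V a z + mulTensor M V b z := by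
  induction z with
  | zero => simp
  | add x y hx hy => rw [map_add, map_add, map_add, hx, hy]; abel
  | tmul s v => simp [TensorProduct.add_tmul]

lemma mulTensor_mul (V : Type) [AddCommGroup V] [Module ℂ V] (a b : R) (z : M ⊗[ℂ] V) :
    mulTensor M V (a * b) z = mulTensor M V a (mulTensor M V b z) := by
  induction z with
  | zero => simp
  | add x y hx hy => rw [map_add, map_add, map_add, hx, hy]
  | tmul s v => exact congrArg (· ⊗ₜ[ℂ] v) (mul_smul a b s)

lemma mulTensor_zero (V : Type) [AddCommGroup V] [Module ℂ V] (z : M ⊗[ℂ] V) :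
    mulTensor M V (0 : R) z = 0 := by
  induction z with
  | zero => simp
  | add x y hx hy => rw [map_add, hx, hy, add_zero]
  | tmul s v => simp

lemma mulTensor_one (V : Type) [AddCommGroup V] [Module ℂ V] (z : M ⊗[ℂ] V) :
    mulTensor M V (1 : R) z = z := by
  induction z with
  | zero => simp
  | add x y hx hy => rw [map_add, hx, hy]
  | tmul s v => simp

/-- The exterior product `x ↦ g ∧ x`. -/
noncomputable def wedge (g : G) (j : ℕ) : ⋀[ℂ]^j G →ₗ[ℂ] ⋀[ℂ]^(j + 1) G :=
  exteriorPower.alternatingMapLinearEquiv ((exteriorPower.ιMulti ℂ (j + 1)).curryLeft g)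

lemma wedge_ιMulti (g : G) (j : ℕ) (v : Fin j → G) :
    wedge g j (exteriorPower.ιMulti ℂ j v) = exteriorPower.ιMulti ℂ (j + 1) (Fin.cons g v) := by
  simp [wedge]
  rfl

variable {M} in
lemma koszul_tensor_induction {j : ℕ} {N : Type} [AddCommGroup N] [Module ℂ N]
    {f g : M ⊗[ℂ] ⋀[ℂ]^j G →ₗ[ℂ] N}
    (h : ∀ s v, f (s ⊗ₜ exteriorPower.ιMulti ℂ j v) = g (s ⊗ₜ exteriorPower.ιMulti ℂ j v)) :
    f = g :=
  TensorProduct.ext (LinearMap.ext fun s ↦ exteriorPower.linearMap_ext (AlternatingMap.ext (h s)))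

lemma koszulModD_wedge_zero (g : G) (z : M ⊗[ℂ] ⋀[ℂ]^0 G) :
    koszulModD φ M 0 ((wedge g 0).lTensor M z) = mulTensor M _ (φ g) z := by
  suffices h : koszulModD φ M 0 ∘ₗ (wedge g 0).lTensor M = mulTensor M _ (φ g) from
    LinearMap.congr_fun h z
  refine koszul_tensor_induction fun s v ↦ ?_
  simp only [LinearMap.comp_apply, LinearMap.lTensor_tmul, wedge_ιMulti, koszulD_tmul_ιMulti]
  simp

/-- The homotopy `d (g ∧ z) + g ∧ d z = φ(g) z`: omitting the first factor `g` gives the right-hand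
side, and omitting a later factor costs one extra sign. In degree zero the term with `d z` is
absent, hence the separate version above. -/
lemma koszulModD_wedge_succ (g : G) (j : ℕ) (z : M ⊗[ℂ] ⋀[ℂ]^(j + 1) G) :
    koszulModD φ M (j + 1) ((wedge g (j + 1)).lTensor M z) =
      mulTensor M _ (φ g) z - (wedge g j).lTensor M (koszulModD φ M j z) := by
  suffices h : koszulModD φ M (j + 1) ∘ₗ (wedge g (j + 1)).lTensor M =
      mulTensor M _ (φ g) - (wedge g j).lTensor M ∘ₗ koszulModD φ M j from
    LinearMap.congr_fun h z
  refine koszul_tensor_induction fun s v ↦ ?_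
  simp only [LinearMap.comp_apply, LinearMap.lTensor_tmul, wedge_ιMulti, koszulD_tmul_ιMulti,
    LinearMap.sub_apply, map_sum, map_zsmul]
  rw [Fin.sum_univ_succ, sub_eq_add_neg, ← Finset.sum_neg_distrib]
  congr 1
  · simp
  · refine Finset.sum_congr rfl fun i _ ↦ ?_
    rw [← neg_smul]
    congr 1
    · simp [pow_succ]
    · simp only [Fin.cons_succ]
      congr 2
      ext k
      induction k using Fin.cases with
      | zero => rfl
      | succ k => simp [Fin.removeNth]

/-- The elements of the ideal generated by `φ` annihilate the Koszul homology. -/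
lemma exists_koszulModD_eq_mulTensor {a : R} (ha : a ∈ Ideal.span (Set.range φ)) (j : ℕ)
    (z : M ⊗[ℂ] ⋀[ℂ]^(j + 1) G) (hz : koszulModD φ M j z = 0) :
    ∃ w, koszulModD φ M (j + 1) w = mulTensor M _ a z := by
  induction ha using Submodule.span_induction with
  | mem x hx =>
    obtain ⟨g, rfl⟩ := hx
    exact ⟨(wedge g (j + 1)).lTensor M z, by rw [koszulModD_wedge_succ, hz]; simp⟩
  | zero => exact ⟨0, by rw [mulTensor_zero, map_zero]⟩
  | add x y _ _ hx hy =>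
    obtain ⟨w, hw⟩ := hx
    obtain ⟨w', hw'⟩ := hy
    exact ⟨w + w', by rw [map_add, hw, hw', mulTensor_add]⟩
  | smul b x _ hx =>
    obtain ⟨w, hw⟩ := hx
    exact ⟨mulTensor M _ b w, by rw [← koszulModD_mulTensor, hw, smul_eq_mul, mulTensor_mul]⟩

lemma exists_koszulModD_zero_eq_mulTensor {a : R} (ha : a ∈ Ideal.span (Set.range φ))
    (z : M ⊗[ℂ] ⋀[ℂ]^0 G) : ∃ w, koszulModD φ M 0 w = mulTensor M _ a z := by
  induction ha using Submodule.span_induction with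
  | mem x hx =>
    obtain ⟨g, rfl⟩ := hx
    exact ⟨(wedge g 0).lTensor M z, by rw [koszulModD_wedge_zero]⟩
  | zero => exact ⟨0, by rw [mulTensor_zero, map_zero]⟩
  | add x y _ _ hx hy =>
    obtain ⟨w, hw⟩ := hx
    obtain ⟨w', hw'⟩ := hy
    exact ⟨w + w', by rw [map_add, hw, hw', mulTensor_add]⟩
  | smul b x _ hx =>
    obtain ⟨w, hw⟩ := hx
    exact ⟨mulTensor M _ b w, by rw [← koszulModD_mulTensor, hw, smul_eq_mul, mulTensor_mul]⟩

/-- The Koszul homology in degree `j + 1`. -/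
abbrev koszulModH (j : ℕ) : Type :=
  LinearMap.ker (koszulModD φ M j) ⧸
    (LinearMap.range (koszulModD φ M (j + 1))).submoduleOf (LinearMap.ker (koszulModD φ M j))

/-- Exactness of the Koszul complex in degree `j + 1`. -/
def KoszulModExact (j : ℕ) : Prop :=
  ∀ z, koszulModD φ M j z = 0 → ∃ w, koszulModD φ M (j + 1) w = z

lemma koszulModD_ker_mulTensor_injective {f : R} (hf : IsSMulRegular M f) (V : Type)
    [AddCommGroup V] [Module ℂ V] : Function.Injective (mulTensor M V f) :=
  Module.Flat.rTensor_preserves_injective_linearMap (M := V)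
    ((LinearMap.lsmul R M f).restrictScalars ℂ) hf

/-- Reduction modulo `f` of the Koszul complex. -/
noncomputable abbrev redTensor (f : R) (V : Type) [AddCommGroup V] [Module ℂ V] :
    M ⊗[ℂ] V →ₗ[ℂ] QuotSMulTop f M ⊗[ℂ] V :=
  (((f • (⊤ : Submodule R M)).mkQ).restrictScalars ℂ).rTensor V

lemma redTensor_surjective (f : R) (V : Type) [AddCommGroup V] [Module ℂ V] :
    Function.Surjective (redTensor M f V) :=
  LinearMap.rTensor_surjective V (Submodule.mkQ_surjective (f • (⊤ : Submodule R M)))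

/-- Right exactness of `- ⊗ V` applied to `M → M → M / fM`. -/
lemma redTensor_eq_zero_iff (f : R) (V : Type) [AddCommGroup V] [Module ℂ V] (z : M ⊗[ℂ] V) :
    redTensor M f V z = 0 ↔ ∃ u, mulTensor M V f u = z := by
  refine (rTensor_exact V (f := (LinearMap.lsmul R M f).restrictScalars ℂ)
    (g := ((f • (⊤ : Submodule R M)).mkQ).restrictScalars ℂ) (fun x ↦ ?_)
    (Submodule.mkQ_surjective (f • (⊤ : Submodule R M)))) z
  rw [LinearMap.restrictScalars_apply, Submodule.mkQ_apply, Submodule.Quotient.mk_eq_zero,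
    Submodule.mem_smul_pointwise_iff_exists]
  simp

/-- In the long exact sequence of `0 → M → M → M / fM → 0` the map `f` is zero on homology, so
`H_{j+2}(M / fM)` surjects onto `H_{j+1}(M)`. The proof chases elements in place of building that
sequence. -/
lemma koszulModExact_of_quotSMulTop {f : R} (hf : IsSMulRegular M f)
    (hI : f ∈ Ideal.span (Set.range φ)) {j : ℕ}
    (h : KoszulModExact φ (QuotSMulTop f M) (j + 1)) : KoszulModExact φ M j := by
  intro z hz
  obtain ⟨w, hw⟩ := exists_koszulModD_eq_mulTensor φ M hI j z hz
  obtain ⟨v, hv⟩ := h (redTensor M f _ w) (by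
    rw [← koszulModD_rTensor, hw, redTensor_eq_zero_iff]
    exact ⟨z, rfl⟩)
  obtain ⟨v, rfl⟩ := redTensor_surjective M f _ v
  rw [← koszulModD_rTensor, ← sub_eq_zero, ← map_sub, redTensor_eq_zero_iff] at hv
  obtain ⟨u, hu⟩ := hv
  -- Here `d w = f z` and `d v - w = f u`, so `f d(-u) = d w = f z`, and `f` cancels.
  refine ⟨-u, koszulModD_ker_mulTensor_injective M hf _ ?_⟩
  rw [koszulModD_mulTensor, map_neg, hu, neg_sub, map_sub, koszulModD_comp_apply, sub_zero, hw]

/-- The connecting isomorphism `H_{j+2}(M / f M) ≃ H_{j+1}(M)` for a regular `f`. -/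
lemma nonempty_koszulModH_equiv {f : R} (hf : IsSMulRegular M f)
    (hI : f ∈ Ideal.span (Set.range φ)) {j : ℕ} (h : KoszulModExact φ M (j + 1)) :
    Nonempty (koszulModH φ (QuotSMulTop f M) (j + 1) ≃ₗ[ℂ] koszulModH φ M j) := by
  have hinj := koszulModD_ker_mulTensor_injective M hf (⋀[ℂ]^(j + 1) G)
  -- `T` consists of the chains whose boundary is divisible by `f`. It maps to both homologies: `α`
  -- takes the class of the reduction modulo `f`, and `β` the class of the boundary divided by `f`.
  -- Both maps are onto and have the same kernel, so both targets are the same quotient of `T`.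
  let T : Submodule ℂ (M ⊗[ℂ] ⋀[ℂ]^(j + 2) G) :=
    (LinearMap.range (mulTensor M (⋀[ℂ]^(j + 1) G) f)).comap (koszulModD φ M (j + 1))
  let e := LinearEquiv.ofInjective _ hinj
  let q : T →ₗ[ℂ] M ⊗[ℂ] ⋀[ℂ]^(j + 1) G :=
    e.symm.toLinearMap ∘ₗ (koszulModD φ M (j + 1)).restrict (fun x hx ↦ hx)
  have hq : ∀ t : T, mulTensor M _ f (q t) = koszulModD φ M (j + 1) t := fun t ↦ by
    have := e.apply_symm_apply ((koszulModD φ M (j + 1)).restrict (fun x (hx : x ∈ T) ↦ hx) t)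
    exact congrArg Subtype.val this
  have hq0 : ∀ t : T, q t ∈ LinearMap.ker (koszulModD φ M j) := fun t ↦ by
    refine koszulModD_ker_mulTensor_injective M hf _ ?_
    rw [koszulModD_mulTensor, hq, koszulModD_comp_apply, map_zero]
  have hr0 : ∀ t : T, redTensor M f _ t.1 ∈
      LinearMap.ker (koszulModD φ (QuotSMulTop f M) (j + 1)) := fun t ↦ by
    rw [LinearMap.mem_ker, ← koszulModD_rTensor, redTensor_eq_zero_iff]
    exact t.2
  let α : T →ₗ[ℂ] koszulModH φ (QuotSMulTop f M) (j + 1) :=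
    Submodule.mkQ _ ∘ₗ (redTensor M f _ ∘ₗ T.subtype).codRestrict _ hr0
  let β : T →ₗ[ℂ] koszulModH φ M j := Submodule.mkQ _ ∘ₗ q.codRestrict _ hq0
  have hα : Function.Surjective α := by
    intro y
    obtain ⟨⟨y, hy⟩, rfl⟩ := Submodule.mkQ_surjective _ y
    obtain ⟨w, rfl⟩ := redTensor_surjective M f _ y
    rw [LinearMap.mem_ker, ← koszulModD_rTensor, redTensor_eq_zero_iff] at hy
    exact ⟨⟨w, hy⟩, rfl⟩
  have hβ : Function.Surjective β := by
    intro y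
    obtain ⟨⟨y, hy⟩, rfl⟩ := Submodule.mkQ_surjective _ y
    obtain ⟨w, hw⟩ := exists_koszulModD_eq_mulTensor φ M hI j y hy
    refine ⟨⟨w, y, hw.symm⟩, congrArg _ (Subtype.ext (hinj ?_))⟩
    -- Surjectivity of `β` is where `f` annihilating the homology of `M` enters: `f y` is a
    -- boundary.
    exact (hq ⟨w, y, hw.symm⟩).trans hw
  have hker : LinearMap.ker α = LinearMap.ker β := by
    ext t
    have h1 : t ∈ LinearMap.ker α ↔
        ∃ v, koszulModD φ (QuotSMulTop f M) (j + 2) v = redTensor M f _ t.1 := by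
      rw [LinearMap.mem_ker]
      exact Submodule.Quotient.mk_eq_zero _
    have h2 : t ∈ LinearMap.ker β ↔ ∃ u, koszulModD φ M (j + 1) u = q t := by
      rw [LinearMap.mem_ker]
      exact Submodule.Quotient.mk_eq_zero _
    rw [h1, h2]
    constructor
    · rintro ⟨v, hv⟩
      obtain ⟨v, rfl⟩ := redTensor_surjective M f _ v
      rw [← koszulModD_rTensor, ← sub_eq_zero, ← map_sub, redTensor_eq_zero_iff] at hv
      obtain ⟨u, hu⟩ := hv
      refine ⟨-u, hinj ?_⟩
      rw [koszulModD_mulTensor, map_neg, hu, neg_sub, map_sub, koszulModD_comp_apply, sub_zero, hq]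
    · rintro ⟨u, hu⟩
      -- If `d t = f d u`, then `t - f u` is a cycle, hence a boundary by exactness for `M` one
      -- degree higher; modulo `f` it equals `t`.
      obtain ⟨w, hw⟩ := h (t.1 - mulTensor M _ f u) (by
        rw [map_sub, ← koszulModD_mulTensor, hu, hq, sub_self])
      refine ⟨redTensor M f _ w, ?_⟩
      rw [← koszulModD_rTensor, hw, map_sub, sub_eq_self, redTensor_eq_zero_iff]
      exact ⟨u, rfl⟩
  exact ⟨(α.quotKerEquivOfSurjective hα).symm ≪≫ₗ Submodule.quotEquivOfEq _ _ hker ≪≫ₗ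
    β.quotKerEquivOfSurjective hβ⟩

lemma exteriorPower_subsingleton [FiniteDimensional ℂ G] {j : ℕ} (hj : Module.finrank ℂ G < j) :
    Subsingleton (⋀[ℂ]^j G) := by
  apply Module.finrank_zero_iff (R := ℂ).1
  rw [exteriorPower.finrank_eq, Nat.choose_eq_zero_of_lt hj]

variable {φ}

-- Homology vanishes above degree `dim G - length rs`. With no elements this says that `Λ^{j+1} G =
-- 0` beyond the dimension; each further regular element lowers the bound by one.
open RingTheory.Sequence in
lemma koszulModExact_of_isWeaklyRegular [FiniteDimensional ℂ G] {rs : List R}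
    (hrs : ∀ r ∈ rs, r ∈ Ideal.span (Set.range φ)) :
    ∀ (M : Type) [AddCommGroup M] [Module R M] [Module ℂ M] [IsScalarTower ℂ R M],
      IsWeaklyRegular M rs → ∀ j : ℕ, Module.finrank ℂ G < j + 1 + rs.length →
        KoszulModExact φ M j := by
  induction rs with
  | nil =>
    intro M _ _ _ _ _ j hj z hz
    have := exteriorPower_subsingleton (G := G) hj
    exact ⟨0, Subsingleton.elim _ _⟩
  | cons r rs ih =>
    intro M _ _ _ _ hreg j hj
    obtain ⟨h1, h2⟩ := (isWeaklyRegular_cons_iff M r rs).1 hreg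
    refine koszulModExact_of_quotSMulTop φ M h1 (hrs r (by simp))
      (ih (fun s hs ↦ hrs s (by simp [hs])) _ h2 (j + 1) ?_)
    simp only [List.length_cons] at hj
    omega

-- The highest possibly nonzero homology, in degree `dim G - length rs`. Each connecting isomorphism
-- replaces `M` by `M / rM` and raises the degree by one, until the degree is `dim G` and the module
-- is `M / (rs)M`. The hypothesis on `φ g • s` makes `φ` act by zero there.
open RingTheory.Sequence in
lemma nonempty_koszulModH_equiv_quotient [FiniteDimensional ℂ G] {rs : List R}
    (hrs : ∀ r ∈ rs, r ∈ Ideal.span (Set.range φ)) :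
    ∀ (M : Type) [AddCommGroup M] [Module R M] [Module ℂ M] [IsScalarTower ℂ R M],
      IsWeaklyRegular M rs →
      (∀ g (s : M), φ g • s ∈ (Ideal.ofList rs • ⊤ : Submodule R M)) →
      ∀ j : ℕ, j + 1 + rs.length = Module.finrank ℂ G →
        Nonempty (koszulModH φ M j ≃ₗ[ℂ] M ⧸ (Ideal.ofList rs • ⊤ : Submodule R M)) := by
  induction rs with
  | nil =>
    intro M _ _ _ _ _ hM j hj
    have hbot : (Ideal.ofList ([] : List R) • ⊤ : Submodule R M) = ⊥ := by simp
    have hact : actionMap φ M = 0 := by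
      ext g s
      have := hM g s
      rw [hbot, Submodule.mem_bot] at this
      simpa using this
    have hd : ∀ k, koszulModD φ M k = 0 := fun k ↦ koszul_tensor_induction fun s v ↦ by
      rw [koszulD_tmul_ιMulti, hact]
      simp
    have hker : LinearMap.ker (koszulModD φ M j) = ⊤ := by rw [hd, LinearMap.ker_zero]
    have hrange : (LinearMap.range (koszulModD φ M (j + 1))).submoduleOf
        (LinearMap.ker (koszulModD φ M j)) = ⊥ := by
      rw [hd (j + 1), LinearMap.range_zero]
      simp [Submodule.submoduleOf]
    have hrank : Module.finrank ℂ (⋀[ℂ]^(j + 1) G) = Module.finrank ℂ ℂ := by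
      rw [exteriorPower.finrank_eq, ← hj]
      simp
    -- All differentials vanish and `j + 1 = dim G`, so the homology is `M` tensored with a line.
    -- The isomorphism depends on a choice of basis of this line.
    exact ⟨Submodule.quotEquivOfEqBot _ hrange ≪≫ₗ LinearEquiv.ofEq _ _ hker ≪≫ₗ
      Submodule.topEquiv ≪≫ₗ (LinearEquiv.ofFinrankEq _ _ hrank).lTensor M ≪≫ₗ
      TensorProduct.rid ℂ M ≪≫ₗ ((Submodule.quotEquivOfEqBot _ hbot).restrictScalars ℂ).symm⟩
  | cons r rs ih =>
    intro M _ _ _ _ hreg hM j hj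
    obtain ⟨h1, h2⟩ := (isWeaklyRegular_cons_iff M r rs).1 hreg
    simp only [List.length_cons] at hj
    obtain ⟨e⟩ := nonempty_koszulModH_equiv φ M h1 (hrs r (by simp)) (j := j)
      (koszulModExact_of_isWeaklyRegular hrs M hreg (j + 1) (by simp; omega))
    let e' := Submodule.quotOfListConsSMulTopEquivQuotSMulTopInner M r rs
    -- The hypothesis on `φ` passes to `M / rM`: the image of `(r, rs)M` is `(rs)(M / rM)`, as `r`
    -- acts by zero.
    obtain ⟨e''⟩ := ih (fun s hs ↦ hrs s (by simp [hs])) _ h2 (fun g s ↦ by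
      obtain ⟨s, rfl⟩ := Submodule.mkQ_surjective _ s
      rw [← map_smul]
      have := Submodule.mem_map_of_mem (f := (r • (⊤ : Submodule R M)).mkQ) (hM g s)
      rw [Ideal.ofList_cons, Submodule.sup_smul, Submodule.map_sup, Submodule.map_smul'',
        Submodule.map_smul'', Submodule.map_top, Submodule.range_mkQ] at this
      refine (sup_le (Submodule.smul_le.2 fun a ha x _ ↦ ?_) le_rfl :
        Ideal.span {r} • (⊤ : Submodule R (QuotSMulTop r M)) ⊔ Ideal.ofList rs • ⊤ ≤ _) this
      obtain ⟨b, rfl⟩ := Ideal.mem_span_singleton'.1 ha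
      rw [mul_smul, Module.mem_annihilator.1 (QuotSMulTop.mem_annihilator M r) x, smul_zero]
      exact zero_mem _) (j + 1) (by omega)
    exact ⟨e.symm ≪≫ₗ e'' ≪≫ₗ (e'.restrictScalars ℂ).symm⟩

/-- The degree zero term of the Koszul complex. -/
noncomputable def koszulModZeroEquiv : M ⊗[ℂ] ⋀[ℂ]^0 G ≃ₗ[ℂ] M :=
  (exteriorPower.zeroEquiv ℂ G).lTensor M ≪≫ₗ TensorProduct.rid ℂ M

omit [IsScalarTower ℂ R M] [Module R M] in
lemma koszulModZeroEquiv_tmul (s : M) (v : Fin 0 → G) :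
    koszulModZeroEquiv M (s ⊗ₜ exteriorPower.ιMulti ℂ 0 v) = s := by
  simp [koszulModZeroEquiv]

lemma koszulModZeroEquiv_mulTensor (a : R) (z : M ⊗[ℂ] ⋀[ℂ]^0 G) :
    koszulModZeroEquiv M (mulTensor M _ a z) = a • koszulModZeroEquiv M z := by
  suffices h : (koszulModZeroEquiv M).toLinearMap ∘ₗ mulTensor M (⋀[ℂ]^0 G) a =
      (LinearMap.lsmul R M a).restrictScalars ℂ ∘ₗ (koszulModZeroEquiv M).toLinearMap from
    LinearMap.congr_fun h z
  refine koszul_tensor_induction fun s v ↦ ?_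
  simp [koszulModZeroEquiv_tmul]

lemma koszulModZeroEquiv_koszulModD_tmul (s : M) (v : Fin (0 + 1) → G) :
    koszulModZeroEquiv M (koszulModD φ M 0 (s ⊗ₜ exteriorPower.ιMulti ℂ (0 + 1) v)) = φ (v 0) • s := by
  rw [koszulModD, koszulD_tmul_ιMulti]
  simp [koszulModZeroEquiv_tmul]

lemma koszulModZeroEquiv_koszulModD_mem (z : M ⊗[ℂ] ⋀[ℂ]^(0 + 1) G) :
    koszulModZeroEquiv M (koszulModD φ M 0 z) ∈
      (Ideal.span (Set.range φ) • ⊤ : Submodule R M) := by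
  induction z with
  | zero => simp
  | add x y hx hy => rw [map_add, map_add]; exact add_mem hx hy
  | tmul s x =>
    have hx : x ∈ Submodule.span ℂ (Set.range (exteriorPower.ιMulti ℂ (0 + 1) (M := G))) := by
      rw [exteriorPower.ιMulti_span]
      trivial
    induction hx using Submodule.span_induction with
    | mem x hx =>
      obtain ⟨v, rfl⟩ := hx
      rw [koszulModZeroEquiv_koszulModD_tmul]
      exact Submodule.smul_mem_smul (Ideal.subset_span ⟨_, rfl⟩) trivial
    | zero => simp
    | add x y _ _ hx hy =>
      rw [TensorProduct.tmul_add, map_add, map_add]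
      exact add_mem hx hy
    | smul c x _ hx =>
      rw [TensorProduct.tmul_smul, map_smul, map_smul]
      exact Submodule.smul_of_tower_mem _ c hx

/-- One inclusion is checked on decomposable elements; the other uses the degree zero homotopy,
which exhibits `a s` as a boundary for every `a` in the ideal. -/
lemma mem_range_koszulModD_zero_iff (z : M ⊗[ℂ] ⋀[ℂ]^0 G) :
    z ∈ LinearMap.range (koszulModD φ M 0) ↔
      koszulModZeroEquiv M z ∈ (Ideal.span (Set.range φ) • ⊤ : Submodule R M) := by
  refine ⟨?_, fun hz ↦ ?_⟩
  · rintro ⟨w, rfl⟩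
    exact koszulModZeroEquiv_koszulModD_mem M w
  · obtain ⟨x, rfl⟩ := (koszulModZeroEquiv (G := G) M).symm.surjective z
    rw [LinearEquiv.apply_symm_apply] at hz
    refine Submodule.smul_induction_on (p := fun x ↦ (koszulModZeroEquiv M).symm x ∈
      LinearMap.range (koszulModD φ M 0)) hz (fun a ha s _ ↦ ?_) fun x y hx hy ↦ ?_
    · obtain ⟨w, hw⟩ := exists_koszulModD_zero_eq_mulTensor φ M ha ((koszulModZeroEquiv M).symm s)
      refine ⟨w, (koszulModZeroEquiv M).injective ?_⟩
      rw [hw, koszulModZeroEquiv_mulTensor, LinearEquiv.apply_symm_apply,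
        LinearEquiv.apply_symm_apply]
    · rw [map_add]
      exact add_mem hx hy

/-- `H_0` of the Koszul complex. -/
lemma nonempty_koszulModH_zero_equiv :
    Nonempty (((M ⊗[ℂ] ⋀[ℂ]^0 G) ⧸ LinearMap.range (koszulModD φ M 0)) ≃ₗ[ℂ]
      M ⧸ (Ideal.span (Set.range φ) • ⊤ : Submodule R M)) := by
  let q : M ⊗[ℂ] ⋀[ℂ]^0 G →ₗ[ℂ] M ⧸ (Ideal.span (Set.range φ) • ⊤ : Submodule R M) :=
    ((Ideal.span (Set.range φ) • ⊤ : Submodule R M).mkQ.restrictScalars ℂ) ∘ₗ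
      (koszulModZeroEquiv M).toLinearMap
  have hq : Function.Surjective q :=
    (Submodule.mkQ_surjective _).comp (koszulModZeroEquiv M).surjective
  have hker : LinearMap.range (koszulModD φ M 0) = LinearMap.ker q := by
    ext z
    rw [mem_range_koszulModD_zero_iff, LinearMap.mem_ker]
    exact (Submodule.Quotient.mk_eq_zero _).symm
  exact ⟨Submodule.quotEquivOfEq _ _ hker ≪≫ₗ q.quotKerEquivOfSurjective hq⟩

end KoszulHomology
end KoszulHyper

namespace KoszulHyper

/-! ### Dimension of local rings, compactness and noetherianity -/

section Dimension

/-- Induction on the number of variables. A polynomial ring over a field is Jacobson, so a maximal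
ideal of `A[T]` contracts to a maximal ideal of `A`, and the height grows by one. -/
lemma MvPolynomial_height_of_isMaximal {K : Type*} [Field K] (n : ℕ)
    (P : Ideal (MvPolynomial (Fin n) K)) (hP : P.IsMaximal) : P.height = n := by
  induction n with
  | zero =>
    have h : P.height ≤ ringKrullDim (MvPolynomial (Fin 0) K) :=
      Ideal.height_le_ringKrullDim_of_ne_top hP.ne_top
    rw [MvPolynomial.ringKrullDim_of_isNoetherianRing] at h
    simp at h
    simpa using h
  | succ n ih =>
    let e := (MvPolynomial.finSuccEquiv K n).toRingEquiv
    have h1 : (P.comap e.symm).IsMaximal := Ideal.comap_isMaximal_of_equiv e.symm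
    let Q : Ideal (Polynomial (MvPolynomial (Fin n) K)) := P.comap e.symm
    have h2 : (Q.comap Polynomial.C).IsMaximal :=
      Polynomial.isMaximal_comap_C_of_isJacobsonRing Q
    have : Q.LiesOver (Q.comap Polynomial.C) := ⟨rfl⟩
    have h3 := Polynomial.height_eq_height_add_one (Q.comap Polynomial.C) Q
    rw [ih _ h2] at h3
    have h4 : Q.height = P.height := RingEquiv.height_comap e.symm P
    rw [← h4, h3]
    simp

/-- Flatness gives going down, so the height of `P` is that of its contraction `p` plus the height
of `P` in the fibre `S / pS`. The fibre contributes zero by quasi-finiteness, and `p` is maximal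
because `S / P` is finite over the polynomial ring. -/
lemma height_of_isMaximal_of_etale {K S : Type*} [Field K] [CommRing S] {n : ℕ}
    (g : MvPolynomial (Fin n) K →+* S) (hg : g.Etale) (P : Ideal S) [hP : P.IsMaximal] :
    P.height = n := by
  algebraize [g]
  have : Algebra.FiniteType (MvPolynomial (Fin n) K) S := inferInstance
  have : IsNoetherianRing S := Algebra.FiniteType.isNoetherianRing (MvPolynomial (Fin n) K) S
  let A := MvPolynomial (Fin n) K
  let := Ideal.Quotient.field P
  have : Module.Finite A (S ⧸ P) := finite_of_finite_type_of_isJacobsonRing A (S ⧸ P)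
  have hp : (P.under A).IsMaximal := by
    have h := Ideal.isMaximal_comap_of_isIntegral_of_isMaximal (R := A) (⊥ : Ideal (S ⧸ P))
    have h' : (⊥ : Ideal (S ⧸ P)).comap (algebraMap A (S ⧸ P)) = P.under A := by
      rw [IsScalarTower.algebraMap_eq A S (S ⧸ P), ← Ideal.comap_comap, ← RingHom.ker_eq_comap_bot,
        Ideal.Quotient.algebraMap_eq, Ideal.mk_ker]
    exact h' ▸ h
  have : Module.Flat A S := inferInstance
  have : Algebra.QuasiFinite A S := inferInstance
  let I := (P.under A).map (algebraMap A S)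
  have hI : I ≤ P := Ideal.map_comap_le
  have hprime : (P.map (Ideal.Quotient.mk I)).IsPrime := Ideal.isPrime_map_quotientMk_of_isPrime hI
  have hmin : (P.map (Ideal.Quotient.mk I)).height = 0 := by
    rw [Ideal.height_eq_zero_iff]
    refine ⟨⟨hprime, bot_le⟩, fun Q ⟨hQ, _⟩ hQP ↦ ?_⟩
    have h1 : Q.comap (Ideal.Quotient.mk I) ≤ P := by
      have := Ideal.comap_mono (f := Ideal.Quotient.mk I) hQP
      rwa [Ideal.comap_map_of_surjective _ Ideal.Quotient.mk_surjective,
        ← RingHom.ker_eq_comap_bot, Ideal.mk_ker, sup_eq_left.2 hI] at this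
    -- Both primes lie over the maximal ideal `p`, and a quasi-finite algebra has no strict
    -- inclusions between primes of one fibre.
    have h2 : Q.comap (Ideal.Quotient.mk I) = P := by
      refine Algebra.QuasiFinite.eq_of_le_of_under_eq (R := A) _ _ h1 ?_
      refine (hp.eq_of_le (Ideal.IsPrime.ne_top inferInstance) ?_).symm
      rw [← Ideal.map_le_iff_le_comap]
      intro x hx
      rw [Ideal.mem_comap, Ideal.Quotient.eq_zero_iff_mem.2 hx]
      exact zero_mem _
    rw [← h2, Ideal.map_comap_of_surjective _ Ideal.Quotient.mk_surjective]
  rw [Ideal.height_eq_height_add_of_liesOver_of_hasGoingDown (P.under A) P,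
    MvPolynomial_height_of_isMaximal n _ hp, hmin, add_zero]

lemma height_of_isMaximal_of_isStandardSmoothOfRelativeDimension {K S : Type*} [CommRing K]
    (hK : IsField K) [CommRing S] {n : ℕ} (f : K →+* S)
    (hf : f.IsStandardSmoothOfRelativeDimension n) (P : Ideal S) [hP : P.IsMaximal] :
    P.height = n := by
  let := hK.toField
  obtain ⟨g, -, hg⟩ := RingHom.IsStandardSmoothOfRelativeDimension.exists_etale_mvPolynomial hf
  exact height_of_isMaximal_of_etale g hg P

/-- The dimension of the local ring at a closed point of a smooth scheme over a field. -/
lemma ringKrullDim_stalk_of_smoothOfRelativeDimension {X : Scheme.{0}} (f : X ⟶ SpecC) (n : ℕ)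
    [SmoothOfRelativeDimension n f] (x : X) (hx : IsClosed {x}) :
    ringKrullDim (X.presheaf.stalk x) = n := by
  obtain ⟨U, hU, V, hV, hxV, e, hf⟩ :=
    SmoothOfRelativeDimension.exists_isStandardSmoothOfRelativeDimension (n := n) (f := f) x
  -- `Spec ℂ` is a single point, so the base of the smooth chart is all of it.
  have hUtop : U = ⊤ := by
    have : Subsingleton SpecC := inferInstanceAs (Subsingleton (PrimeSpectrum ℂ))
    ext y
    rw [Subsingleton.elim y (f x)]
    simpa using e hxV
  subst hUtop
  have hK : IsField Γ(SpecC, ⊤) :=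
    (Scheme.ΓSpecIso (CommRingCat.of ℂ)).commRingCatIsoToRingEquiv.toMulEquiv.isField
      (Field.toIsField ℂ)
  have := hV.primeIdealOf_isMaximal_of_isClosed ⟨x, hxV⟩ hx
  let := X.presheaf.algebra_section_stalk ⟨x, hxV⟩
  have := hV.isLocalization_stalk ⟨x, hxV⟩
  have h := IsLocalization.AtPrime.ringKrullDim_eq_height (hV.primeIdealOf ⟨x, hxV⟩).asIdeal
    (X.presheaf.stalk x)
  refine h.trans ?_
  rw [ height_of_isMaximal_of_isStandardSmoothOfRelativeDimension hK _ hf]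
  rfl

/-- A regular sequence generating an ideal with zero-dimensional quotient. -/
lemma length_eq_of_isRegular {R : Type*} [CommRing R] [IsLocalRing R] [IsNoetherianRing R]
    {n : ℕ} (hR : ringKrullDim R = n) {rs : List R} (hrs : RingTheory.Sequence.IsRegular R rs)
    [IsArtinianRing (R ⧸ Ideal.ofList rs)] : rs.length = n := by
  have h := ringKrullDim_add_length_eq_ringKrullDim_of_isRegular rs hrs
  have : Nontrivial (R ⧸ Ideal.ofList rs) := by
    refine Ideal.Quotient.nontrivial_iff.2 fun h ↦ hrs.top_ne_smul ?_
    rw [h]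
    simp
  have h0 : ringKrullDim (R ⧸ Ideal.ofList rs) = 0 := by
    have : Ring.KrullDimLE 0 (R ⧸ Ideal.ofList rs) := inferInstance
    exact ringKrullDimZero_iff_ringKrullDim_eq_zero.1 this
  rw [h0, hR, zero_add] at h
  exact_mod_cast h

/-- Since the polynomial ring is of finite type over its degree zero part, `Proj` is quasi-compact
over an affine scheme. Projectivity enters the theorem only through the compactness deduced from
this. -/
lemma compactSpace_projSpace (N : ℕ) : CompactSpace (ProjSpace N) := by
  let := MvPolynomial.gradedAlgebra (σ := Fin (N + 1)) (R := ℂ)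
  have : IsScalarTower ℂ (MvPolynomial.homogeneousSubmodule (Fin (N + 1)) ℂ 0)
    (MvPolynomial (Fin (N + 1)) ℂ) := 
    ⟨fun a b c ↦ smul_mul_assoc a (b : MvPolynomial (Fin (N + 1)) ℂ) c⟩
  have : Algebra.FiniteType (MvPolynomial.homogeneousSubmodule (Fin (N + 1)) ℂ 0)
      (MvPolynomial (Fin (N + 1)) ℂ) := Algebra.FiniteType.of_restrictScalars_finiteType ℂ _ _
  have : CompactSpace (Proj (MvPolynomial.homogeneousSubmodule (Fin (N + 1)) ℂ)) :=
    QuasiCompact.compactSpace_of_compactSpace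
      (Proj.toSpecZero (MvPolynomial.homogeneousSubmodule (Fin (N + 1)) ℂ))
  exact this

lemma IsProjective.compactSpace {X : Scheme.{0}} [X.Over SpecC] (h : IsProjective X) :
    CompactSpace X := by
  obtain ⟨N, i, hi, -⟩ := h
  have := compactSpace_projSpace N
  exact QuasiCompact.compactSpace_of_compactSpace i

lemma isLocallyNoetherian_of_smoothOfRelativeDimension {X : Scheme.{0}} (f : X ⟶ SpecC) (n : ℕ)
    [SmoothOfRelativeDimension n f] : IsLocallyNoetherian X := by
  have := SmoothOfRelativeDimension.smooth n f
  exact LocallyOfFiniteType.isLocallyNoetherian f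

end Dimension
end KoszulHyper

namespace KoszulHyper

/-! ### The ideal sheaf generated by `G` in local frames -/

section ZeroIdeal

variable {X : Scheme.{0}}

/-- The closed subscheme of an affine open subset defined by an ideal, as a scheme over `X`. -/
noncomputable def affineClosed {V : X.Opens} (hV : IsAffineOpen V) (I : Ideal Γ(X, V)) :
    Spec (CommRingCat.of (Γ(X, V) ⧸ I)) ⟶ X :=
  Spec.map (CommRingCat.ofHom (Ideal.Quotient.mk I)) ≫ hV.fromSpec

lemma affineClosed_preimage {V : X.Opens} (hV : IsAffineOpen V) (I : Ideal Γ(X, V)) :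
    affineClosed hV I ⁻¹ᵁ V = ⊤ := by
  rw [affineClosed, Scheme.Hom.comp_preimage, hV.fromSpec_preimage_self]
  rfl

lemma affineClosed_appLE {V : X.Opens} (hV : IsAffineOpen V) (I : Ideal Γ(X, V)) :
    (affineClosed hV I).appLE V ⊤ (affineClosed_preimage hV I).ge =
      CommRingCat.ofHom (Ideal.Quotient.mk I) ≫ (Scheme.ΓSpecIso _).inv := by
  rw [Scheme.ΓSpecIso_inv_naturality]
  have h : hV.fromSpec.appLE V ⊤ hV.fromSpec_preimage_self.ge = (Scheme.ΓSpecIso Γ(X, V)).inv := by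
    rw [Scheme.Hom.appLE, hV.fromSpec_app_self, Category.assoc, ← Functor.map_comp]
    exact (congrArg _ ((Spec Γ(X, V)).presheaf.map_id _)).trans (Category.comp_id _)
  refine Eq.trans ?_ (congrArg (· ≫ (Spec.map (CommRingCat.ofHom (Ideal.Quotient.mk I))).appTop) h)
  rw [Scheme.Hom.appTop, Scheme.Hom.app_eq_appLE]
  exact (Scheme.Hom.appLE_comp_appLE _ _ _ _ _ _ _).symm

lemma affineClosed_appLE_eq_zero_iff {V : X.Opens} (hV : IsAffineOpen V) (I : Ideal Γ(X, V))
    (s : Γ(X, V)) :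
    (affineClosed hV I).appLE V ⊤ (affineClosed_preimage hV I).ge s = 0 ↔ s ∈ I := by
  rw [affineClosed_appLE]
  refine Iff.trans ?_ Ideal.Quotient.eq_zero_iff_mem
  exact map_eq_zero_iff (Scheme.ΓSpecIso _).inv.hom
    (Scheme.ΓSpecIso (CommRingCat.of (Γ(X, V) ⧸ I))).symm.commRingCatIsoToRingEquiv.injective

/-- This kernel extends an ideal given on one affine open to an ideal sheaf on `X` without changing
it there. Quasi-separatedness makes the morphism quasi-compact, so that its kernel can be computed
on sections. -/
lemma ker_affineClosed [QuasiSeparatedSpace X] {V : X.affineOpens} (I : Ideal Γ(X, V)) :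
    (affineClosed V.2 I).ker.ideal V = I := by
  rw [Scheme.Hom.ker_apply]
  ext s
  rw [RingHom.mem_ker, ← affineClosed_appLE_eq_zero_iff V.2]
  have h := affineClosed_preimage V.2 I
  rw [Scheme.Hom.appLE]
  refine (map_eq_zero_iff ((Spec _).presheaf.map (homOfLE h.ge).op).hom ?_).symm
  have : IsIso (homOfLE h.ge) := ⟨homOfLE h.le, rfl, rfl⟩
  exact (ConcreteCategory.bijective_of_isIso ((Spec _).presheaf.map (homOfLE h.ge).op)).1

/-- The subscheme lies over `V`, so vanishing of its pullback over `W` can be tested on `V ⊓ W`. -/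
lemma mem_ker_affineClosed [QuasiSeparatedSpace X] {V : X.Opens} (hV : IsAffineOpen V)
    (I : Ideal Γ(X, V)) (W : X.affineOpens) (s : Γ(X, W.1)) (t : Γ(X, V)) (ht : t ∈ I)
    (u : Γ(X, V ⊓ W.1)) (h : X.presheaf.map (homOfLE inf_le_right).op s =
      u * X.presheaf.map (homOfLE inf_le_left).op t) : s ∈ (affineClosed hV I).ker.ideal W := by
  rw [Scheme.Hom.ker_apply, RingHom.mem_ker]
  have hle : affineClosed hV I ⁻¹ᵁ W.1 ≤ affineClosed hV I ⁻¹ᵁ (V ⊓ W.1) := fun x hx ↦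
    ⟨(affineClosed_preimage hV I).ge trivial, hx⟩
  have h1 : (affineClosed hV I).app W.1 s = (affineClosed hV I).appLE (V ⊓ W.1) _ hle
      (X.presheaf.map (homOfLE inf_le_right).op s) := by
    rw [Scheme.Hom.app_eq_appLE, ← Scheme.Hom.map_appLE _ hle (homOfLE inf_le_right).op]
    rfl
  have h2 : (affineClosed hV I).appLE (V ⊓ W.1) _ hle
      (X.presheaf.map (homOfLE inf_le_left).op t) = 0 := by
    have h3 : X.presheaf.map (homOfLE (inf_le_left : V ⊓ W.1 ≤ V)).op ≫
        (affineClosed hV I).appLE (V ⊓ W.1) _ hle =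
        (affineClosed hV I).appLE V ⊤ (affineClosed_preimage hV I).ge ≫
          (Spec _).presheaf.map (homOfLE le_top).op := by
      rw [Scheme.Hom.map_appLE, Scheme.Hom.appLE_map]
    refine (ConcreteCategory.congr_hom h3 t).trans ?_
    rw [CategoryTheory.comp_apply, (affineClosed_appLE_eq_zero_iff hV I t).2 ht, map_zero]
  change (affineClosed hV I).app W.1 s = 0
  rw [h1, h, map_mul, h2, mul_zero]

lemma Frame.exists_unitSMul_eq {L : X.Modules} {V : X.Opens} (e e' : Frame L V) :
    ∃ u : Γ(X, V)ˣ, e' = e.unitSMul u := by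
  have key : ∀ f : Frame L V, L.presheaf.map (homOfLE (le_refl V)).op f.val = f.val := fun f ↦
    ConcreteCategory.congr_hom (L.presheaf.map_id (op V)) f.val
  obtain ⟨r, hr⟩ := (e.bijective V le_rfl).2 e'.val
  obtain ⟨r', hr'⟩ := (e'.bijective V le_rfl).2 e.val
  simp only [key] at hr hr'
  have h1 : r' * r = 1 := (e.bijective V le_rfl).1 (by
    simp only [key]
    rw [mul_smul, hr, hr', one_smul])
  refine ⟨⟨r, r', by rw [mul_comm, h1], h1⟩, ?_⟩
  rcases e' with ⟨v, hv⟩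
  simp only [Frame.unitSMul, Frame.mk.injEq]
  exact hr.symm

variable [X.Over SpecC] (L : X.Modules) (D : ℕ) (G : Submodule ℂ (powSections L D ⊤))

/-- The ideal of functions on `V` generated by the coordinates of the elements of `G` in a
frame. -/
def frameIdeal {V : X.Opens} (e : Frame L V) : Ideal Γ(X, V) :=
  Ideal.span (Set.range fun g : G ↦ g.1.1 ⟨V, le_top⟩ e)

variable {L} in
lemma frameIdeal_coordinate_mem_ker [QuasiSeparatedSpace X] {V : X.affineOpens} (e : Frame L V.1)
    (g : powSections L D ⊤) (hg : g ∈ G) (W : X.affineOpens) (e' : Frame L W.1) :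
    g.1 ⟨W.1, le_top⟩ e' ∈ (affineClosed V.2 (frameIdeal L D G e)).ker.ideal W := by
  -- On the overlap the two frames differ by a unit `u`, and the coordinates of a section of `L^D`
  -- by `u^{-D}`.
  obtain ⟨u, hu⟩ := (e.restrict (inf_le_left : V.1 ⊓ W.1 ≤ V.1)).exists_unitSMul_eq
    (e'.restrict inf_le_right)
  refine mem_ker_affineClosed V.2 _ W _ (g.1 ⟨V.1, le_top⟩ e)
    (Ideal.subset_span ⟨⟨g, hg⟩, rfl⟩) ((u ^ (-(D : ℤ)) : Γ(X, V.1 ⊓ W.1)ˣ) : Γ(X, V.1 ⊓ W.1)) ?_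
  rw [← g.2.1 ⟨W.1, le_top⟩ ⟨V.1 ⊓ W.1, le_top⟩ inf_le_right e', hu, g.2.2,
    g.2.1 ⟨V.1, le_top⟩ ⟨V.1 ⊓ W.1, le_top⟩ inf_le_left e]

omit [X.Over SpecC] in
variable {L} in
lemma IsInvertible.exists_affine_frame (hL : IsInvertible L) (x : X) :
    ∃ V : X.affineOpens, x ∈ V.1 ∧ Nonempty (Frame L V.1) := by
  obtain ⟨V, hx, ⟨e⟩⟩ := hL x
  obtain ⟨W, hW, hxW, hWV⟩ := exists_isAffineOpen_mem_and_subset hx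
  exact ⟨⟨W, hW⟩, hxW, ⟨e.restrict hWV⟩⟩

/-- The ideal sheaf is defined as an infimum, so its local values must be found. The intersection
`J` of the extended frame ideals over a finite cover contains all coordinates and has the frame
ideals as values on the cover; every competitor contains `J` there. Compactness keeps the
intersection finite, so that it is computed on sections. -/
lemma exists_generatedIdeal_eq [QuasiSeparatedSpace X] [CompactSpace X] (hL : IsInvertible L)
    (x : X) : ∃ (V : X.affineOpens) (e : Frame L V.1), x ∈ V.1 ∧
      (generatedIdeal L D G).ideal V = frameIdeal L D G e := by
  choose V hxV e using hL.exists_affine_frame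
  obtain ⟨t, ht⟩ := CompactSpace.elim_nhds_subcover (fun x ↦ ((V x).1 : Set X))
    fun x ↦ (V x).1.isOpen.mem_nhds (hxV x)
  let f : ∀ x, Frame L (V x).1 := fun x ↦ (e x).some
  let J : X.IdealSheafData := ⨅ i : t, (affineClosed (V i).2 (frameIdeal L D G (f i))).ker
  have hJ : J ∈ {J : X.IdealSheafData | ∀ g ∈ G, ∀ (V : X.affineOpens) (e : Frame L V.1),
      g.1 ⟨V.1, le_top⟩ e ∈ J.ideal V} := by
    intro g hg W e'
    rw [Scheme.IdealSheafData.ideal_iInf, iInf_apply, Submodule.mem_iInf]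
    exact fun i ↦ frameIdeal_coordinate_mem_ker D G (f i) g hg W e'
  have hJV : ∀ i : t, J.ideal (V i) = frameIdeal L D G (f i) := by
    intro i
    refine le_antisymm ?_ ?_
    · rw [Scheme.IdealSheafData.ideal_iInf, iInf_apply]
      exact (iInf_le _ i).trans_eq (ker_affineClosed _)
    · refine Ideal.span_le.2 ?_
      rintro _ ⟨g, rfl⟩
      exact hJ g.1 g.2 (V i) (f i)
  have hcov : ⨆ i : t, (V i).1 = ⊤ := by
    ext y
    simpa using ht.ge (Set.mem_univ y)
  have hgen : generatedIdeal L D G = J := by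
    refine le_antisymm (sInf_le hJ) (le_sInf fun J' hJ' ↦ ?_)
    refine Scheme.IdealSheafData.le_of_iSup_eq_top (fun i : t ↦ V i) hcov fun i ↦ ?_
    rw [hJV]
    refine Ideal.span_le.2 ?_
    rintro _ ⟨g, rfl⟩
    exact hJ' g.1 g.2 (V i) (f i)
  obtain ⟨i, hi⟩ := Opens.mem_iSup.1 (hcov.ge (Set.mem_univ x))
  exact ⟨V i, f i, hi, by rw [hgen, hJV]⟩

end ZeroIdeal

/-! ### Stalks of a closed subscheme -/

section SubschemeStalk

variable {X : Scheme.{0}} (J : X.IdealSheafData)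

/-- Quotients commute with localization. A germ `s / t` in the kernel has `c s = 0` on the subscheme
for some `c` invertible at `z`. A lift `c'` of `c` to `V` is invertible in the stalk, since the
stalk map is local, and `c' s` lies in the ideal. -/
lemma ker_stalkMap_subschemeι (z : J.subscheme) (V : X.affineOpens) (hz : J.subschemeι z ∈ V.1) :
    RingHom.ker (J.subschemeι.stalkMap z).hom =
      (J.ideal V).map (X.presheaf.germ V.1 (J.subschemeι z) hz).hom := by
  have hgerm : ∀ s : Γ(X, V.1), J.subschemeι.stalkMap z (X.presheaf.germ V.1 _ hz s) =
      J.subscheme.presheaf.germ (J.subschemeι ⁻¹ᵁ V.1) z hz (J.subschemeι.app V.1 s) :=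
    Scheme.Hom.germ_stalkMap_apply _ _ _ _
  refine le_antisymm (fun a ha ↦ ?_) ?_
  · let := X.presheaf.algebra_section_stalk (⟨J.subschemeι z, hz⟩ : V.1)
    have hloc := V.2.isLocalization_stalk ⟨J.subschemeι z, hz⟩
    have hV' : IsAffineOpen (J.subschemeι ⁻¹ᵁ V.1) := V.2.preimage J.subschemeι
    let := J.subscheme.presheaf.algebra_section_stalk (⟨z, hz⟩ : (J.subschemeι ⁻¹ᵁ V.1 : _))
    have hloc' := hV'.isLocalization_stalk ⟨z, hz⟩
    obtain ⟨⟨s, t⟩, hst⟩ := IsLocalization.surj (V.2.primeIdealOf ⟨_, hz⟩).asIdeal.primeCompl a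
    have ht : IsUnit (X.presheaf.germ V.1 _ hz t.1) := IsLocalization.map_units _ t
    replace hst : a * X.presheaf.germ V.1 _ hz t.1 = X.presheaf.germ V.1 _ hz s := hst
    have hs0 : J.subscheme.presheaf.germ (J.subschemeι ⁻¹ᵁ V.1) z hz (J.subschemeι.app V.1 s) =
        0 := by
      rw [← hgerm, ← hst, map_mul]
      exact (congrArg (· * _) ha).trans (zero_mul _)
    obtain ⟨c, hc⟩ := (IsLocalization.map_eq_zero_iff
      (hV'.primeIdealOf ⟨z, hz⟩).asIdeal.primeCompl (J.subscheme.presheaf.stalk z) _).1 hs0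
    obtain ⟨c', hc'⟩ := J.subschemeι_app_surjective V c.1
    have hcu : IsUnit (X.presheaf.germ V.1 _ hz c') := by
      have h1 : IsUnit (J.subscheme.presheaf.germ (J.subschemeι ⁻¹ᵁ V.1) z hz c.1) :=
        IsLocalization.map_units (J.subscheme.presheaf.stalk z) c
      rw [← hc', ← hgerm] at h1
      exact (isUnit_map_iff (J.subschemeι.stalkMap z).hom _).1 h1
    have hmem : c' * s ∈ J.ideal V := by
      rw [← J.ker_subschemeι_app V, RingHom.mem_ker]
      change J.subschemeι.app V.1 (c' * s) = 0
      rw [map_mul, hc', hc]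
    have h2 := Ideal.mem_map_of_mem (X.presheaf.germ V.1 (J.subschemeι z) hz).hom hmem
    replace h2 : X.presheaf.germ V.1 _ hz c' * (a * X.presheaf.germ V.1 _ hz t.1) ∈
        (J.ideal V).map (X.presheaf.germ V.1 (J.subschemeι z) hz).hom := by
      rw [hst, ← map_mul]
      exact h2
    rw [Ideal.unit_mul_mem_iff_mem _ hcu, Ideal.mul_unit_mem_iff_mem _ ht] at h2
    exact h2
  · rw [Ideal.map_le_iff_le_comap]
    intro s hs
    rw [← J.ker_subschemeι_app V, RingHom.mem_ker] at hs
    rw [Ideal.mem_comap, RingHom.mem_ker]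
    refine (hgerm s).trans ?_
    exact (congrArg _ hs).trans (map_zero _)

lemma map_germ_ideal_eq_top (x : X) (hx : x ∉ Set.range J.subschemeι) (V : X.affineOpens)
    (hxV : x ∈ V.1) : (J.ideal V).map (X.presheaf.germ V.1 x hxV).hom = ⊤ := by
  rw [J.range_subschemeι] at hx
  have h : x ∉ X.zeroLocus (U := V.1) (J.ideal V) := fun h ↦
    hx ((Scheme.IdealSheafData.mem_support_iff_of_mem hxV).2 h)
  rw [Scheme.mem_zeroLocus_iff] at h
  push Not at h
  obtain ⟨f, hf, hxf⟩ := h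
  exact Ideal.eq_top_of_isUnit_mem _ (Ideal.mem_map_of_mem _ hf) ((X.mem_basicOpen f x hxV).1 hxf)

end SubschemeStalk

end KoszulHyper

namespace KoszulHyper

/-! ### Stalks of tensor products and of the Koszul differential -/

section StalkTrivialization

variable {X : TopCat.{0}} (F F' : TopCat.Presheaf (ModuleCat.{0} ℂ) X) (x : X)
  (R : Type) [CommRing R] [Algebra ℂ R]

/-- An identification of the stalk of `F` at `x` with `R`, in terms of sections. -/
structure StalkTrivialization where
  coord : ∀ U : Opens X, x ∈ U → F.obj (op U) →ₗ[ℂ] R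
  coord_res : ∀ {U U' : Opens X} (h : U' ≤ U) (hx : x ∈ U') (s : F.obj (op U)),
    coord U' hx ((F.map (homOfLE h).op).hom s) = coord U (h hx) s
  exists_coord_eq : ∀ r : R, ∃ (U : Opens X) (hx : x ∈ U) (s : F.obj (op U)), coord U hx s = r
  exists_res_eq_zero : ∀ (U : Opens X) (hx : x ∈ U) (s : F.obj (op U)), coord U hx s = 0 →
    ∃ (W : Opens X) (_ : x ∈ W) (h : W ≤ U), (F.map (homOfLE h).op).hom s = 0

variable {F F' x R} (c : StalkTrivialization F x R) (c' : StalkTrivialization F' x R)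
  (W : Type) [AddCommGroup W] [Module ℂ W]

/-- The map from the stalk of `F ⊗ W` to `R ⊗ W`. -/
noncomputable def StalkTrivialization.toTensor :
    (tensorPresheaf F W).stalk x ⟶ ModuleCat.of ℂ (R ⊗[ℂ] W) :=
  Limits.colimit.desc ((OpenNhds.inclusion x).op ⋙ tensorPresheaf F W)
    { pt := ModuleCat.of ℂ (R ⊗[ℂ] W)
      ι :=
        { app U := ModuleCat.ofHom ((c.coord U.unop.1 U.unop.2).rTensor W)
          naturality U U' i := by
            refine ModuleCat.hom_ext (TensorProduct.ext' fun a w ↦ ?_)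
            exact congrArg (· ⊗ₜ w) (c.coord_res i.unop.le U'.unop.2 a) } }

lemma StalkTrivialization.toTensor_germ (U : Opens X) (hxU : x ∈ U) (t : F.obj (op U) ⊗[ℂ] W) :
    (c.toTensor W).hom (((tensorPresheaf F W).germ U x hxU).hom t) =
      (c.coord U hxU).rTensor W t :=
  ConcreteCategory.congr_hom (Limits.colimit.ι_desc
    (F := (OpenNhds.inclusion x).op ⋙ tensorPresheaf F W) _ (op ⟨U, hxU⟩)) t

/-- In a basis of `W` each coordinate of `t` dies on some neighbourhood; the basis is finite, so
these neighbourhoods have an open intersection. -/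
lemma StalkTrivialization.exists_rTensor_res_eq_zero [FiniteDimensional ℂ W] (U : Opens X)
    (hxU : x ∈ U) (t : F.obj (op U) ⊗[ℂ] W) (ht : (c.coord U hxU).rTensor W t = 0) :
    ∃ (U' : Opens X) (_ : x ∈ U') (h : U' ≤ U),
      ((F.map (homOfLE h).op).hom.rTensor W) t = 0 := by
  let b := Module.finBasis ℂ W
  let β (M : Type) [AddCommGroup M] [Module ℂ M] := TensorProduct.equivFinsuppOfBasisRight (M := M) b
  have hβ : ∀ {M N : Type} [AddCommGroup M] [Module ℂ M] [AddCommGroup N] [Module ℂ N]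
      (f : M →ₗ[ℂ] N) (y : M ⊗[ℂ] W) (q), β N (f.rTensor W y) q = f (β M y q) := by
    intro M N _ _ _ _ f y q
    induction y with
    | zero => simp
    | add y z hy hz => simp only [map_add, Finsupp.add_apply, hy, hz]
    | tmul m w => simp [β]
  have h1 : ∀ q, ∃ (U' : Opens X) (_ : x ∈ U') (h : U' ≤ U),
      (F.map (homOfLE h).op).hom (β _ t q) = 0 := fun q ↦
    c.exists_res_eq_zero U hxU _ (by rw [← hβ, ht, map_zero, Finsupp.zero_apply])
  choose U' hxU' hU' h0 using h1
  refine ⟨U ⊓ ⨅ q, U' q, ⟨hxU, ?_⟩, inf_le_left, ?_⟩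
  · rw [Opens.coe_iInf]
    exact Set.mem_iInter.2 hxU'
  · refine (β _).injective (Finsupp.ext fun q ↦ ?_)
    refine (hβ _ _ _).trans ?_
    rw [map_zero, Finsupp.zero_apply]
    have hle : U ⊓ ⨅ q, U' q ≤ U' q := inf_le_right.trans (iInf_le _ q)
    have h2 := congrArg (F.map (homOfLE hle).op).hom (h0 q)
    rw [map_zero, ← LinearMap.comp_apply, ← ModuleCat.hom_comp, ← F.map_comp] at h2
    exact h2

lemma StalkTrivialization.bijective_toTensor [FiniteDimensional ℂ W] :
    Function.Bijective (c.toTensor W).hom := by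
  constructor
  · rw [← LinearMap.ker_eq_bot, LinearMap.ker_eq_bot']
    intro y hy
    obtain ⟨U, hxU, t, rfl⟩ := TopCat.Presheaf.exists_germ_eq (tensorPresheaf F W) y
    have h1 := (c.toTensor_germ W U hxU t).symm.trans hy
    obtain ⟨U', hxU', h, h0⟩ := c.exists_rTensor_res_eq_zero W U hxU t h1
    rw [← TopCat.Presheaf.germ_res_apply (tensorPresheaf F W) (homOfLE h) x hxU' t]
    exact (congrArg _ h0).trans (map_zero _)
  · rw [← LinearMap.range_eq_top, eq_top_iff, ← TensorProduct.span_tmul_eq_top, Submodule.span_le]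
    rintro _ ⟨r, w, rfl⟩
    obtain ⟨U, hxU, a, rfl⟩ := c.exists_coord_eq r
    exact ⟨((tensorPresheaf F W).germ U x hxU).hom (a ⊗ₜ w), c.toTensor_germ W U hxU _⟩

/-- The stalk of `F ⊗ W` at `x` is `R ⊗ W`. -/
noncomputable def StalkTrivialization.tensorEquiv [FiniteDimensional ℂ W] :
    (tensorPresheaf F W).stalk x ≃ₗ[ℂ] R ⊗[ℂ] W :=
  LinearEquiv.ofBijective _ (c.bijective_toTensor W)

variable {G : Type} [AddCommGroup G] [Module ℂ G] [FiniteDimensional ℂ G]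

lemma StalkTrivialization.tensorEquiv_koszulPresheafHom
    (μ : ∀ U, G →ₗ[ℂ] F.obj U →ₗ[ℂ] F'.obj U) (hμ) (φ : G →ₗ[ℂ] R)
    (h : ∀ (U : Opens X) (hx : x ∈ U) (g : G) (s : F.obj (op U)),
      c'.coord U hx (μ (op U) g s) = φ g * c.coord U hx s) (j : ℕ)
    (y : (tensorPresheaf F (⋀[ℂ]^(j + 1) G)).stalk x) :
    c'.tensorEquiv (⋀[ℂ]^j G) (((TopCat.Presheaf.stalkFunctor (ModuleCat.{0} ℂ) x).map
      (koszulPresheafHom μ hμ j)).hom y) =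
    koszulModD φ R j (c.tensorEquiv (⋀[ℂ]^(j + 1) G) y) := by
  obtain ⟨U, hxU, t, rfl⟩ := TopCat.Presheaf.exists_germ_eq (tensorPresheaf F (⋀[ℂ]^(j + 1) G)) y
  refine (congrArg (c'.tensorEquiv (⋀[ℂ]^j G))
    (TopCat.Presheaf.stalkFunctor_map_germ_apply U x hxU (koszulPresheafHom μ hμ j) t)).trans ?_
  refine (c'.toTensor_germ _ U hxU _).trans ?_
  refine Eq.trans ?_ (congrArg (koszulModD φ R j) (c.toTensor_germ _ U hxU t).symm)
  exact LinearMap.congr_fun (koszulD_natural (μ (op U)) (actionMap φ R) (c.coord U hxU)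
    (c'.coord U hxU) (h U hxU) j) t

end StalkTrivialization

/-! ### Stalks of the powers of an invertible sheaf -/

section StalkPow

variable {X : Scheme.{0}} [X.Over SpecC]

lemma germ_algebraMap (U : X.Opens) (x : X) (hx : x ∈ U) (c : ℂ) :
    X.presheaf.germ U x hx (algebraMap ℂ Γ(X, U) c) = algebraMap ℂ (X.presheaf.stalk x) c := by
  rw [← res_algebraMap (le_top : U ≤ ⊤) c]
  exact TopCat.Presheaf.germ_res_apply _ _ _ _ _

/-- The germ of a function, as a linear map. -/
noncomputable def germLinearMap (U : X.Opens) (x : X) (hx : x ∈ U) :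
    Γ(X, U) →ₗ[ℂ] X.presheaf.stalk x where
  toFun := X.presheaf.germ U x hx
  map_add' := map_add _
  map_smul' c r := by
    rw [RingHom.id_apply, Algebra.smul_def, Algebra.smul_def, map_mul, germ_algebraMap]

omit [X.Over SpecC] in
lemma Frame.unitSMul_injective {L : X.Modules} {V : X.Opens} (e : Frame L V) :
    Function.Injective fun u : Γ(X, V)ˣ ↦ e.unitSMul u := by
  intro u v h
  have h1 : (u : Γ(X, V)) • e.val = (v : Γ(X, V)) • e.val := congrArg Frame.val h
  have key : L.presheaf.map (homOfLE (le_refl V)).op e.val = e.val :=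
    ConcreteCategory.congr_hom (L.presheaf.map_id (op V)) e.val
  refine Units.ext ((e.bijective V le_rfl).1 ?_)
  simpa only [key] using h1

/-- The transition function between two frames. -/
noncomputable def Frame.ratio {L : X.Modules} {V : X.Opens} (e e' : Frame L V) : Γ(X, V)ˣ :=
  (e.exists_unitSMul_eq e').choose

omit [X.Over SpecC] in
lemma Frame.unitSMul_ratio {L : X.Modules} {V : X.Opens} (e e' : Frame L V) :
    e.unitSMul (e.ratio e') = e' :=
  (e.exists_unitSMul_eq e').choose_spec.symm

omit [X.Over SpecC] in
lemma Frame.ratio_eq {L : X.Modules} {V : X.Opens} {e e' : Frame L V} {u : Γ(X, V)ˣ}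
    (h : e' = e.unitSMul u) : e.ratio e' = u :=
  e.unitSMul_injective ((e.unitSMul_ratio e').trans h)

omit [X.Over SpecC] in
lemma Frame.unitSMul_unitSMul {L : X.Modules} {V : X.Opens} (e : Frame L V) (u v : Γ(X, V)ˣ) :
    (e.unitSMul u).unitSMul v = e.unitSMul (v * u) := by
  simp [Frame.unitSMul, mul_smul]

variable (L : X.Modules) (k : ℤ)

variable {L} in
/-- Over an open subset with a frame, every function is the coordinate of a section of `L^k`. -/
lemma exists_powSections_coordinate {V : X.Opens} (e : Frame L V) (s : Γ(X, V)) :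
    ∃ a : powSections L k V, a.1 ⟨V, le_rfl⟩ e = s := by
  -- The transformation rule forces this formula: if `e' = u • e`, the coordinate in `e'` is `u^{-k}
  -- s`.
  refine ⟨⟨fun W e' ↦ (((e.restrict W.2).ratio e' ^ (-k) : Γ(X, W.1)ˣ) : Γ(X, W.1)) *
    X.presheaf.map (homOfLE W.2).op s, ?_, ?_⟩, ?_⟩
  · intro W W' h e'
    have h1 : (e.restrict W'.2).ratio (e'.restrict h) =
        Units.map (X.presheaf.map (homOfLE h).op).hom ((e.restrict W.2).ratio e') := by
      refine Frame.ratio_eq ?_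
      conv_lhs => rw [← (e.restrict W.2).unitSMul_ratio e']
      rw [Frame.restrict_unitSMul, Frame.restrict_restrict]
    beta_reduce
    rw [map_mul, res_res, h1, ← map_zpow]
    rfl
  · intro W e' u
    have h1 : (e.restrict W.2).ratio (e'.unitSMul u) = u * (e.restrict W.2).ratio e' := by
      refine Frame.ratio_eq ?_
      rw [← Frame.unitSMul_unitSMul, Frame.unitSMul_ratio]
    beta_reduce
    rw [h1, mul_zpow, Units.val_mul, mul_assoc]
  · have h1 : (e.restrict le_rfl).ratio e = 1 := by
      refine Frame.ratio_eq ?_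
      rw [Frame.restrict_refl]
      simp [Frame.unitSMul]
    change (((e.restrict le_rfl).ratio e ^ (-k) : Γ(X, V)ˣ) : Γ(X, V)) *
      X.presheaf.map (homOfLE le_rfl).op s = s
    rw [h1, one_zpow, Units.val_one, one_mul]
    exact ConcreteCategory.congr_hom (X.presheaf.map_id (op V)) s

variable {L k} in
/-- A section of `L^k` is determined by its coordinate in a frame. -/
lemma powSections_eq_zero_of_coordinate {V : X.Opens} (e : Frame L V) (a : powSections L k V)
    (h : a.1 ⟨V, le_rfl⟩ e = 0) : a = 0 := by
  refine Subtype.ext (funext fun W ↦ funext fun e' ↦ ?_)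
  rw [← (e.restrict W.2).unitSMul_ratio e', a.2.2, a.2.1 ⟨V, le_rfl⟩ W W.2 e, h, map_zero, mul_zero]
  rfl

variable {L} in
/-- The germ at `x` of the coordinate of a section of `L^k`. -/
noncomputable def coordGerm {V : X.Opens} (e : Frame L V) (x : X) (hxV : x ∈ V) (U : X.Opens)
    (hxU : x ∈ U) : powSections L k U →ₗ[ℂ] X.presheaf.stalk x :=
  germLinearMap (U ⊓ V) x ⟨hxU, hxV⟩ ∘ₗ
    { toFun a := a.1 ⟨U ⊓ V, inf_le_left⟩ (e.restrict inf_le_right)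
      map_add' _ _ := rfl
      map_smul' _ _ := rfl }

variable {L k}

lemma coordGerm_eq {V : X.Opens} (e : Frame L V) (x : X) (hxV : x ∈ V) (U : X.Opens)
    (hxU : x ∈ U) (W : X.Opens) (hxW : x ∈ W) (hWU : W ≤ U) (hWV : W ≤ V) (a : powSections L k U) :
    coordGerm k e x hxV U hxU a = X.presheaf.germ W x hxW (a.1 ⟨W, hWU⟩ (e.restrict hWV)) := by
  have h := a.2.1 ⟨U ⊓ V, inf_le_left⟩ ⟨W, hWU⟩ (le_inf hWU hWV) (e.restrict inf_le_right)
  rw [Frame.restrict_restrict] at h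
  rw [h]
  exact (TopCat.Presheaf.germ_res_apply X.presheaf (homOfLE _) _ _ _).symm

lemma coordGerm_res {V : X.Opens} (e : Frame L V) (x : X) (hxV : x ∈ V) {U U' : X.Opens}
    (h : U' ≤ U) (hxU : x ∈ U') (a : powSections L k U) :
    coordGerm k e x hxV U' hxU (((powPresheaf L k).map (homOfLE h).op).hom a) =
      coordGerm k e x hxV U (h hxU) a := by
  rw [coordGerm_eq e x hxV U (h hxU) (U' ⊓ V) ⟨hxU, hxV⟩ (inf_le_left.trans h) inf_le_right]
  rfl

lemma coordGerm_powMul {k l p : ℤ} (hp : k + l = p) {V : X.Opens} (e : Frame L V) (x : X)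
    (hxV : x ∈ V) (U : X.Opens) (hxU : x ∈ U) (a : powSections L k U) (b : powSections L l U) :
    coordGerm p e x hxV U hxU (powMul L hp U a b) =
      coordGerm k e x hxV U hxU a * coordGerm l e x hxV U hxU b :=
  map_mul (X.presheaf.germ (U ⊓ V) x ⟨hxU, hxV⟩).hom _ _

lemma exists_coordGerm_eq {V : X.Opens} (e : Frame L V) (x : X) (hxV : x ∈ V)
    (r : X.presheaf.stalk x) :
    ∃ (U : X.Opens) (hxU : x ∈ U) (a : powSections L k U), coordGerm k e x hxV U hxU a = r := by
  obtain ⟨U, hUV, hxU, s, rfl⟩ := TopCat.Presheaf.exists_le_germ_eq X.presheaf r hxV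
  obtain ⟨a, ha⟩ := exists_powSections_coordinate k (e.restrict hUV) s
  exact ⟨U, hxU, a, by rw [coordGerm_eq e x hxV U hxU U hxU le_rfl hUV, ha]⟩

lemma exists_res_eq_zero_of_coordGerm_eq_zero {V : X.Opens} (e : Frame L V) (x : X) (hxV : x ∈ V)
    (U : X.Opens) (hxU : x ∈ U) (a : powSections L k U) (ha : coordGerm k e x hxV U hxU a = 0) :
    ∃ (W : X.Opens) (_ : x ∈ W) (h : W ≤ U), ((powPresheaf L k).map (homOfLE h).op).hom a = 0 := by
  rw [coordGerm_eq e x hxV U hxU (U ⊓ V) ⟨hxU, hxV⟩ inf_le_left inf_le_right,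
    ← map_zero (X.presheaf.germ (U ⊓ V) x ⟨hxU, hxV⟩).hom] at ha
  obtain ⟨W, hxW, i, i', hi⟩ := TopCat.Presheaf.germ_eq X.presheaf x _ _ _ _ ha
  have hWV : W ≤ V := i.le.trans inf_le_right
  have hWU : W ≤ U := i.le.trans inf_le_left
  refine ⟨W, hxW, hWU, powSections_eq_zero_of_coordinate (e.restrict hWV) _ ?_⟩
  have h := a.2.1 ⟨U ⊓ V, inf_le_left⟩ ⟨W, hWU⟩ i.le (e.restrict inf_le_right)
  rw [Frame.restrict_restrict] at h
  exact h.trans (hi.trans (map_zero _))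


variable (k) in
/-- The identification of the stalk of `L^k` at `x` with `𝒪_{X,x}` defined by a frame. -/
noncomputable def powTrivialization {V : X.Opens} (e : Frame L V) (x : X) (hxV : x ∈ V) :
    StalkTrivialization (powPresheaf L k) x (X.presheaf.stalk x) where
  coord U hxU :=
    { toFun := coordGerm k e x hxV U hxU
      map_add' := map_add (coordGerm k e x hxV U hxU)
      map_smul' := map_smul (coordGerm k e x hxV U hxU) }
  coord_res h hxU a := coordGerm_res e x hxV h hxU a
  exists_coord_eq := exists_coordGerm_eq e x hxV
  exists_res_eq_zero U hxU a := exists_res_eq_zero_of_coordGerm_eq_zero e x hxV U hxU a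

variable {D : ℕ} (G : Submodule ℂ (powSections L D ⊤))

/-- The germs at `x` of the coordinates of the elements of `G`. -/
noncomputable def coordMap {V : X.Opens} (e : Frame L V) (x : X) (hxV : x ∈ V) :
    G →ₗ[ℂ] X.presheaf.stalk x :=
  coordGerm D e x hxV ⊤ trivial ∘ₗ G.subtype

/-- Links the ideal that governs the Koszul complex on the stalk to the ideal sheaf of the zero
scheme. -/
lemma span_range_coordMap {V : X.Opens} (e : Frame L V) (x : X) (hxV : x ∈ V) :
    Ideal.span (Set.range (coordMap G e x hxV)) =
      (frameIdeal L D G e).map (X.presheaf.germ V x hxV).hom := by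
  rw [frameIdeal, Ideal.map_span, ← Set.range_comp]
  congr 2
  ext g
  refine (coordGerm_eq e x hxV ⊤ trivial V hxV le_top le_rfl g.1).trans ?_
  rw [Frame.restrict_refl]
  rfl

lemma powTrivialization_koszulMul {k l : ℤ} (h : k + D = l) {V : X.Opens} (e : Frame L V) (x : X)
    (hxV : x ∈ V) (U : X.Opens) (hxU : x ∈ U) (g : G) (s : (powPresheaf L k).obj (op U)) :
    (powTrivialization l e x hxV).coord U hxU (koszulMul G h (op U) g s) =
      coordMap G e x hxV g * (powTrivialization k e x hxV).coord U hxU s := by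
  have h1 : coordGerm D e x hxV U hxU (powRes L D U g.1) = coordMap G e x hxV g :=
    coordGerm_res e x hxV le_top hxU g.1
  have h2 := coordGerm_powMul h e x hxV U hxU s (powRes L D U g.1)
  rw [h1, mul_comm] at h2
  exact h2

end StalkPow

end KoszulHyper

namespace KoszulHyper

/-! ### Exactness of stalks -/

section SheafStalk

variable {X : TopCat.{0}}

/-- The stalk at `x` of a sheaf of complex vector spaces. -/
noncomputable def sheafStalk (x : X) :
    Sheaf (Opens.grothendieckTopology X) (ModuleCat.{0} ℂ) ⥤ ModuleCat.{0} ℂ :=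
  sheafToPresheaf _ _ ⋙ TopCat.Presheaf.stalkFunctor (ModuleCat.{0} ℂ) x

instance (x : X) : (sheafStalk x).Additive :=
  inferInstanceAs (TopCat.Sheaf.forget (ModuleCat.{0} ℂ) X ⋙
    TopCat.Presheaf.stalkFunctor (ModuleCat.{0} ℂ) x).Additive

instance (x : X) : Limits.PreservesFiniteLimits (sheafStalk x) :=
  inferInstanceAs (Limits.PreservesFiniteLimits (TopCat.Sheaf.forget (ModuleCat.{0} ℂ) X ⋙
    TopCat.Presheaf.stalkFunctor (ModuleCat.{0} ℂ) x))

instance (x : X) : (sheafStalk x).IsLeftAdjoint :=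
  inferInstanceAs (TopCat.Sheaf.forget (ModuleCat.{0} ℂ) X ⋙
    TopCat.Presheaf.stalkFunctor (ModuleCat.{0} ℂ) x).IsLeftAdjoint

instance (x : X) : Limits.PreservesFiniteColimits (sheafStalk x) where
  preservesFiniteColimits _ _ _ := inferInstance

/-- Stalks preserve finite limits and, being left adjoint to skyscrapers, finite colimits. Homology
sheaves can thus be computed on stalks. -/
instance (x : X) : (sheafStalk x).PreservesHomology := inferInstance

lemma isZero_iff_sheafStalk (F : Sheaf (Opens.grothendieckTopology X) (ModuleCat.{0} ℂ)) :
    Limits.IsZero F ↔ ∀ x : X, Limits.IsZero ((sheafStalk x).obj F) :=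
  TopCat.Sheaf.isZero_iff_stalkFunctor_obj_isZero (C := ModuleCat.{0} ℂ) (X := X) F

lemma isIso_of_sheafStalk {F F' : Sheaf (Opens.grothendieckTopology X) (ModuleCat.{0} ℂ)}
    (f : F ⟶ F') (h : ∀ x : X, IsIso ((sheafStalk x).map f)) : IsIso f :=
  (TopCat.Presheaf.isIso_iff_stalkFunctor_map_iso (C := ModuleCat.{0} ℂ) (X := X)
    (F := F) (G := F') f).2 h

end SheafStalk

/-! ### Homology of the Koszul sheaf complex on stalks -/

section ModuleHomology

/-- The homology of a short complex of vector spaces isomorphic to `A → B → C`. -/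
lemma nonempty_homology_equiv (S : ShortComplex (ModuleCat.{0} ℂ)) {A B C : Type}
    [AddCommGroup A] [Module ℂ A] [AddCommGroup B] [Module ℂ B] [AddCommGroup C] [Module ℂ C]
    (f : A →ₗ[ℂ] B) (g : B →ₗ[ℂ] C) (a : S.X₁ ≃ₗ[ℂ] A) (b : S.X₂ ≃ₗ[ℂ] B) (c : S.X₃ ≃ₗ[ℂ] C)
    (hf : ∀ y, b (S.f.hom y) = f (a y)) (hg : ∀ y, c (S.g.hom y) = g (b y)) :
    Nonempty (S.homology ≃ₗ[ℂ]
      LinearMap.ker g ⧸ (LinearMap.range f).submoduleOf (LinearMap.ker g)) := by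
  let e : LinearMap.ker S.g.hom ≃ₗ[ℂ] LinearMap.ker g :=
    b.submoduleMap _ ≪≫ₗ LinearEquiv.ofEq _ _ (by
      ext y
      simp only [Submodule.mem_map, LinearMap.mem_ker]
      refine ⟨?_, fun hy ↦ ⟨b.symm y, ?_, b.apply_symm_apply y⟩⟩
      · rintro ⟨z, hz, rfl⟩
        exact (hg z).symm.trans ((congrArg c hz).trans (map_zero c))
      · refine c.injective ?_
        rw [hg, b.apply_symm_apply, hy, map_zero])
  have he : ∀ y, (e y : B) = b y.1 := fun y ↦ rfl
  refine ⟨S.moduleCatHomologyIso.toLinearEquiv ≪≫ₗ Submodule.Quotient.equiv _ _ e ?_⟩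
  ext y
  rw [Submodule.mem_map]
  change _ ↔ (y : B) ∈ LinearMap.range f
  constructor
  · rintro ⟨_, ⟨z, rfl⟩, rfl⟩
    exact ⟨a z, (hf z).symm⟩
  · rintro ⟨z, hz⟩
    refine ⟨_, ⟨a.symm z, rfl⟩, Subtype.ext ?_⟩
    refine (hf _).trans ?_
    rw [a.apply_symm_apply, hz]

end ModuleHomology

section KoszulSheaf

variable {X : TopCat.{0}} {G : Type} [AddCommGroup G] [Module ℂ G] [FiniteDimensional ℂ G]
  (F : ℕ → TopCat.Presheaf (ModuleCat.{0} ℂ) X)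
  (hF : ∀ j, (tensorPresheaf (F j) (⋀[ℂ]^j G)).IsSheaf)
  (d : ∀ j, tensorPresheaf (F (j + 1)) (⋀[ℂ]^(j + 1) G) ⟶ tensorPresheaf (F j) (⋀[ℂ]^j G))
  (hd : ∀ j, d (j + 1) ≫ d j = 0)

/-- The sheaf `F_j ⊗ Λ^j G`. -/
noncomputable def tensorTerm (j : ℕ) : Sheaf (Opens.grothendieckTopology X) (ModuleCat.{0} ℂ) :=
  ⟨tensorPresheaf (F j) (⋀[ℂ]^j G), hF j⟩

/-- The differential `F_{j+1} ⊗ Λ^{j+1} G → F_j ⊗ Λ^j G`. -/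
noncomputable def tensorDiff (j : ℕ) : tensorTerm F hF (j + 1) ⟶ tensorTerm F hF j :=
  ⟨d j⟩

/-- A complex of sheaves `⋯ → F_1 ⊗ G → F_0`. -/
noncomputable def tensorChainComplex :
    ChainComplex (Sheaf (Opens.grothendieckTopology X) (ModuleCat.{0} ℂ)) ℕ :=
  ChainComplex.of (tensorTerm F hF) (tensorDiff F hF d) fun j ↦ Sheaf.hom_ext (hd j)

omit [FiniteDimensional ℂ G] in
lemma tensorChainComplex_d (j : ℕ) :
    (tensorChainComplex F hF d hd).d (j + 1) j = tensorDiff F hF d j :=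
  ChainComplex.of_d (tensorTerm F hF) (tensorDiff F hF d) j

variable {x : X} {R : Type} [CommRing R] [Algebra ℂ R] (φ : G →ₗ[ℂ] R)
  (c : ∀ j, StalkTrivialization (F j) x R)
  (hc : ∀ j y, (c j).tensorEquiv (⋀[ℂ]^j G)
    (((TopCat.Presheaf.stalkFunctor (ModuleCat.{0} ℂ) x).map (d j)).hom y) =
      koszulModD φ R j ((c (j + 1)).tensorEquiv (⋀[ℂ]^(j + 1) G) y))

include hc

lemma nonempty_stalk_homology_succ_equiv (j : ℕ) :
    Nonempty ((sheafStalk x).obj ((tensorChainComplex F hF d hd).homology (j + 1)) ≃ₗ[ℂ]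
      koszulModH φ R j) := by
  let K := tensorChainComplex F hF d hd
  have e1 := (sheafStalk x).mapIso (K.homologyIsoSc' (j + 2) (j + 1) j (by simp) (by simp)) ≪≫
    ((K.sc' (j + 2) (j + 1) j).mapHomologyIso (sheafStalk x)).symm
  have hd1 : K.d (j + 2) (j + 1) = tensorDiff F hF d (j + 1) := tensorChainComplex_d F hF d hd (j + 1)
  have hd2 : K.d (j + 1) j = tensorDiff F hF d j := tensorChainComplex_d F hF d hd j
  obtain ⟨e2⟩ := nonempty_homology_equiv ((K.sc' (j + 2) (j + 1) j).map (sheafStalk x))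
    (koszulModD φ R (j + 1)) (koszulModD φ R j) ((c (j + 2)).tensorEquiv (⋀[ℂ]^(j + 2) G))
    ((c (j + 1)).tensorEquiv (⋀[ℂ]^(j + 1) G)) ((c j).tensorEquiv (⋀[ℂ]^j G))
    (fun y ↦ by
      refine Eq.trans ?_ (hc (j + 1) y)
      change (c (j + 1)).tensorEquiv _ (((sheafStalk x).map (K.d (j + 2) (j + 1))).hom y) = _
      rw [hd1]
      rfl)
    (fun y ↦ by
      refine Eq.trans ?_ (hc j y)
      change (c j).tensorEquiv _ (((sheafStalk x).map (K.d (j + 1) j)).hom y) = _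
      rw [hd2]
      rfl)
  exact ⟨e1.toLinearEquiv ≪≫ₗ e2⟩

lemma nonempty_stalk_homology_zero_equiv :
    Nonempty ((sheafStalk x).obj ((tensorChainComplex F hF d hd).homology 0) ≃ₗ[ℂ]
      (R ⊗[ℂ] ⋀[ℂ]^0 G) ⧸ LinearMap.range (koszulModD φ R 0)) := by
  let K := tensorChainComplex F hF d hd
  -- Degree `0` has no successor, so the next index is `0` itself by convention and the outgoing map
  -- is zero.
  have e1 := (sheafStalk x).mapIso (K.homologyIsoSc' 1 0 0 (by simp) (by simp)) ≪≫
    ((K.sc' 1 0 0).mapHomologyIso (sheafStalk x)).symm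
  have hd1 : K.d 1 0 = tensorDiff F hF d 0 := tensorChainComplex_d F hF d hd 0
  have hd2 : K.d 0 0 = 0 := K.shape _ _ (by simp)
  obtain ⟨e2⟩ := nonempty_homology_equiv ((K.sc' 1 0 0).map (sheafStalk x))
    (koszulModD φ R 0) (0 : _ →ₗ[ℂ] R ⊗[ℂ] ⋀[ℂ]^0 G) ((c 1).tensorEquiv (⋀[ℂ]^1 G))
    ((c 0).tensorEquiv (⋀[ℂ]^0 G)) ((c 0).tensorEquiv (⋀[ℂ]^0 G))
    (fun y ↦ by
      refine Eq.trans ?_ (hc 0 y)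
      change (c 0).tensorEquiv _ (((sheafStalk x).map (K.d 1 0)).hom y) = _
      rw [hd1]
      rfl)
    (fun y ↦ by
      change (c 0).tensorEquiv _ (((sheafStalk x).map (K.d 0 0)).hom y) = _
      rw [hd2, Functor.map_zero]
      exact map_zero _)
  refine ⟨e1.toLinearEquiv ≪≫ₗ e2 ≪≫ₗ Submodule.Quotient.equiv _ _
    (LinearEquiv.ofTop _ LinearMap.ker_zero) ?_⟩
  ext y
  rw [Submodule.mem_map]
  exact ⟨by rintro ⟨z, hz, rfl⟩; exact hz, fun hy ↦ ⟨⟨y, rfl⟩, hy, rfl⟩⟩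

/-- The element `1` of the ideal annihilates the homology. -/
lemma isZero_stalk_homology_of_span_eq_top (hφ : Ideal.span (Set.range φ) = ⊤) (j : ℕ) :
    Limits.IsZero ((sheafStalk x).obj ((tensorChainComplex F hF d hd).homology j)) := by
  rw [ModuleCat.isZero_iff_subsingleton]
  cases j with
  | zero =>
    obtain ⟨e⟩ := nonempty_stalk_homology_zero_equiv F hF d hd φ c hc
    obtain ⟨e'⟩ := nonempty_koszulModH_zero_equiv (φ := φ) R
    have : Subsingleton (R ⧸ (Ideal.span (Set.range φ) • ⊤ : Submodule R R)) := by
      rw [hφ, Submodule.top_smul]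
      exact Submodule.Quotient.subsingleton_iff.2 rfl
    exact (e.trans e').toEquiv.subsingleton
  | succ j =>
    obtain ⟨e⟩ := nonempty_stalk_homology_succ_equiv F hF d hd φ c hc j
    have : Subsingleton (koszulModH φ R j) := by
      refine Submodule.Quotient.subsingleton_iff.2 (eq_top_iff.2 ?_)
      rintro ⟨z, hz⟩ -
      obtain ⟨w, hw⟩ := exists_koszulModD_eq_mulTensor φ R (hφ.ge (Submodule.mem_top (x := 1))) j z hz
      refine ⟨w, ?_⟩
      rw [hw, mulTensor_one]
      rfl
    exact e.toEquiv.subsingleton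

lemma isZero_stalk_homology_of_isWeaklyRegular {rs : List R}
    (hrs : ∀ r ∈ rs, r ∈ Ideal.span (Set.range φ)) (hreg : RingTheory.Sequence.IsWeaklyRegular R rs)
    (j : ℕ) (hj : Module.finrank ℂ G < j + 1 + rs.length) :
    Limits.IsZero ((sheafStalk x).obj ((tensorChainComplex F hF d hd).homology (j + 1))) := by
  rw [ModuleCat.isZero_iff_subsingleton]
  obtain ⟨e⟩ := nonempty_stalk_homology_succ_equiv F hF d hd φ c hc j
  have : Subsingleton (koszulModH φ R j) := by
    refine Submodule.Quotient.subsingleton_iff.2 (eq_top_iff.2 ?_)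
    rintro ⟨z, hz⟩ -
    obtain ⟨w, hw⟩ := koszulModExact_of_isWeaklyRegular hrs R hreg j hj z hz
    exact ⟨w, hw⟩
  exact e.toEquiv.subsingleton

/-- With one generator more than the length of the regular sequence, the top surviving degree `dim G
- length rs` is exactly `1`. -/
lemma nonempty_stalk_homology_equiv_quotient {rs : List R}
    (hrs : Ideal.span (Set.range φ) = Ideal.ofList rs)
    (hreg : RingTheory.Sequence.IsWeaklyRegular R rs)
    (hj : 1 + rs.length = Module.finrank ℂ G) :
    Nonempty ((sheafStalk x).obj ((tensorChainComplex F hF d hd).homology 0) ≃ₗ[ℂ]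
      R ⧸ Ideal.ofList rs) ∧
    Nonempty ((sheafStalk x).obj ((tensorChainComplex F hF d hd).homology 1) ≃ₗ[ℂ]
      R ⧸ Ideal.ofList rs) := by
  have h1 : (Ideal.ofList rs • ⊤ : Submodule R R) = Ideal.ofList rs := by
    rw [smul_eq_mul, Ideal.mul_top]
  constructor
  · obtain ⟨e⟩ := nonempty_stalk_homology_zero_equiv F hF d hd φ c hc
    obtain ⟨e'⟩ := nonempty_koszulModH_zero_equiv (φ := φ) R
    rw [hrs, h1] at e'
    exact ⟨e ≪≫ₗ e'⟩
  · obtain ⟨e⟩ := nonempty_stalk_homology_succ_equiv F hF d hd φ c hc 0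
    obtain ⟨e'⟩ := nonempty_koszulModH_equiv_quotient (φ := φ)
      (fun r hr ↦ hrs.ge (Ideal.subset_span hr)) R hreg
      (fun g s ↦ by
        rw [h1, smul_eq_mul, ← hrs]
        exact Ideal.mul_mem_right _ _ (Ideal.subset_span ⟨g, rfl⟩)) 0 (by omega)
    rw [h1] at e'
    exact ⟨e ≪≫ₗ e'⟩

end KoszulSheaf

end KoszulHyper

namespace KoszulHyper

/-! ### Sheaves supported at finitely many closed points -/

section Skyscraper

variable {X : TopCat.{0}}

open Classical in
/-- The skyscraper sheaf at `x`. -/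
noncomputable def skyscraper (x : X) :
    ModuleCat.{0} ℂ ⥤ Sheaf (Opens.grothendieckTopology X) (ModuleCat.{0} ℂ) :=
  skyscraperSheafFunctor x

open Classical in
/-- Skyscraper sheaves are right adjoint to stalks. -/
noncomputable def stalkSkyscraperAdjunction (x : X) : sheafStalk x ⊣ skyscraper x :=
  stalkSkyscraperSheafAdjunction (C := ModuleCat.{0} ℂ) x

instance (x : X) (M : ModuleCat.{0} ℂ) : IsIso ((stalkSkyscraperAdjunction x).counit.app M) := by
  classical
  exact inferInstanceAs (IsIso (skyscraperPresheafStalkOfSpecializes x M specializes_rfl).hom)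

lemma isZero_sheafStalk_skyscraper {x y : X} (h : ¬ x ⤳ y) (M : ModuleCat.{0} ℂ) :
    Limits.IsZero ((sheafStalk y).obj ((skyscraper x).obj M)) := by
  classical
  exact Limits.IsZero.of_iso (Limits.isZero_zero _)
    ((skyscraperPresheafStalkOfNotSpecializesIsTerminal x M h).uniqueUpToIso
      (Limits.isZero_zero (ModuleCat.{0} ℂ)).isTerminal)

instance (M : ModuleCat.{0} ℂ) : Injective M :=
  have : Module.Injective ℂ M := Module.injective_of_isSemisimpleRing ℂ M
  Module.injective_object_of_injective_module ℂ M

/-- Vector spaces are injective, and the right adjoint of an exact functor preserves injectives. -/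
instance (x : X) (M : ModuleCat.{0} ℂ) : Injective ((skyscraper x).obj M) :=
  Injective.injective_of_adjoint (stalkSkyscraperAdjunction x) M

instance (x : X) (F : Sheaf (Opens.grothendieckTopology X) (ModuleCat.{0} ℂ)) :
    IsIso ((sheafStalk x).map ((stalkSkyscraperAdjunction x).unit.app F)) := by
  have h := (stalkSkyscraperAdjunction x).left_triangle_components F
  exact IsIso.of_isIso_fac_right (h := 𝟙 _) h

instance : Limits.HasFiniteBiproducts
    (Sheaf (Opens.grothendieckTopology X) (ModuleCat.{0} ℂ)) :=
  Limits.HasFiniteBiproducts.of_hasFiniteProducts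

section FiniteSupport

variable {ι : Type} [Fintype ι] (p : ι → X) (hp : Function.Injective p)
  (hclosed : ∀ i, IsClosed ({p i} : Set X))
  (F : Sheaf (Opens.grothendieckTopology X) (ModuleCat.{0} ℂ))
  (hF : ∀ x, x ∉ Set.range p → Limits.IsZero ((sheafStalk x).obj F))

/-- The map from a sheaf to the sum of the skyscraper sheaves of its stalks at finitely many
points. -/
noncomputable def toSkyscrapers :
    F ⟶ ⨁ fun i ↦ (skyscraper (p i)).obj ((sheafStalk (p i)).obj F) :=
  Limits.biproduct.lift fun i ↦ (stalkSkyscraperAdjunction (p i)).unit.app F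

include hp hclosed hF

/-- Checked on stalks. Since the points are closed, a skyscraper has zero stalk away from its own
point. So at `p i` only the `i`-th summand remains, where the adjunction unit is an isomorphism on
stalks; at other points both sides vanish. -/
lemma isIso_toSkyscrapers : IsIso (toSkyscrapers p F) := by
  classical
  refine isIso_of_sheafStalk _ fun y ↦ ?_
  let S := fun i ↦ (skyscraper (p i)).obj ((sheafStalk (p i)).obj F)
  have hz : ∀ i, p i ≠ y → Limits.IsZero ((sheafStalk y).obj (S i)) := fun i hi ↦
    isZero_sheafStalk_skyscraper (fun h ↦ hi ((h.mem_closed (hclosed i) rfl : y ∈ _)).symm) _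
  have htot : 𝟙 ((sheafStalk y).obj (⨁ S)) = ∑ i,
      (sheafStalk y).map (Limits.biproduct.π S i) ≫ (sheafStalk y).map (Limits.biproduct.ι S i) := by
    rw [← CategoryTheory.Functor.map_id, ← Limits.biproduct.total, Functor.map_sum]
    exact Finset.sum_congr rfl fun i _ ↦ (sheafStalk y).map_comp _ _
  by_cases hy : y ∈ Set.range p
  · obtain ⟨i, rfl⟩ := hy
    have h1 : (sheafStalk (p i)).map (Limits.biproduct.π S i) ≫
        (sheafStalk (p i)).map (Limits.biproduct.ι S i) = 𝟙 _ := by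
      rw [htot, Finset.sum_eq_single i]
      · intro j _ hj
        rw [(hz j (hp.ne hj)).eq_zero_of_tgt ((sheafStalk (p i)).map (Limits.biproduct.π S j)),
          Limits.zero_comp]
      · exact fun h ↦ absurd (Finset.mem_univ i) h
    have h2 : (sheafStalk (p i)).map (Limits.biproduct.ι S i) ≫
        (sheafStalk (p i)).map (Limits.biproduct.π S i) = 𝟙 _ := by
      rw [← Functor.map_comp, Limits.biproduct.ι_π_self, CategoryTheory.Functor.map_id]
    have : IsIso ((sheafStalk (p i)).map (Limits.biproduct.π S i)) := ⟨_, h1, h2⟩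
    have h3 : (sheafStalk (p i)).map (toSkyscrapers p F) ≫
        (sheafStalk (p i)).map (Limits.biproduct.π S i) =
        (sheafStalk (p i)).map ((stalkSkyscraperAdjunction (p i)).unit.app F) := by
      rw [← Functor.map_comp, toSkyscrapers, Limits.biproduct.lift_π]
    exact IsIso.of_isIso_fac_right h3
  · refine Limits.isIso_of_source_target_iso_zero _ (hF y hy).isoZero (Limits.IsZero.isoZero ?_)
    rw [Limits.IsZero.iff_id_eq_zero, htot]
    refine Finset.sum_eq_zero fun i _ ↦ ?_
    rw [(hz i fun h ↦ hy ⟨i, h⟩).eq_zero_of_tgt ((sheafStalk y).map (Limits.biproduct.π S i)),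
      Limits.zero_comp]

lemma injective_of_finite_support : Injective F := by
  have := isIso_toSkyscrapers p hp hclosed F hF
  exact Injective.of_iso (asIso (toSkyscrapers p F)).symm inferInstance

omit [Fintype ι] hp hclosed in
lemma section_eq_of_disjoint (U : Opens X) (hU : ∀ i, p i ∉ U) (s t : F.obj.obj (op U)) : s = t := by
  refine TopCat.Presheaf.section_ext (C := ModuleCat.{0} ℂ) (X := X) F U s t fun x hx ↦ ?_
  have := ModuleCat.isZero_iff_subsingleton.1 (hF x (by rintro ⟨i, rfl⟩; exact hU i hx))
  exact Subsingleton.elim (α := (sheafStalk x).obj F) _ _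

omit [Fintype ι] hp hclosed hF in
/-- The germs of a global section at finitely many points. -/
noncomputable def germsLinearMap : F.obj.obj (op ⊤) →ₗ[ℂ] ∀ i, (sheafStalk (p i)).obj F :=
  LinearMap.pi fun i ↦ (TopCat.Presheaf.germ F.obj ⊤ (p i) trivial).hom

/-- A section is determined by its germs, and germs at the given points glue because all other
stalks are zero. -/
lemma bijective_germsLinearMap : Function.Bijective (germsLinearMap p F) := by
  classical
  constructor
  · intro s t hst
    refine TopCat.Presheaf.section_ext (C := ModuleCat.{0} ℂ) (X := X) F ⊤ s t fun x hx ↦ ?_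
    by_cases h : x ∈ Set.range p
    · obtain ⟨i, rfl⟩ := h
      exact congrFun hst i
    · have := ModuleCat.isZero_iff_subsingleton.1 (hF x h)
      exact Subsingleton.elim (α := (sheafStalk x).obj F) _ _
  · intro v
    choose U hU s hs using fun i ↦ TopCat.Presheaf.exists_germ_eq (F.obj : X.Presheaf _) (v i)
    have hcl : ∀ P : ι → Prop, IsClosed (⋃ i, ⋃ _ : P i, ({p i} : Set X)) := fun P ↦
      isClosed_iUnion_of_finite fun i ↦ isClosed_iUnion_of_finite fun _ ↦ hclosed i
    let W : (ι → Prop) → Opens X := fun P ↦ ⟨(⋃ i, ⋃ _ : P i, ({p i} : Set X))ᶜ, (hcl P).isOpen_compl⟩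
    have hW : ∀ P x, x ∈ W P ↔ ∀ i, P i → x ≠ p i := by
      intro P x
      change x ∈ (⋃ i, ⋃ _ : P i, ({p i} : Set X))ᶜ ↔ _
      simp
    -- The cover: each `U i` without the other points, and the complement of all points, which
    -- carries the zero section. Overlaps of distinct members contain no `p i`, so compatibility is
    -- automatic.
    let V : Option ι → Opens X := fun a ↦ a.elim (W fun _ ↦ True) fun i ↦ U i ⊓ W fun j ↦ j ≠ i
    let t : ∀ a, F.obj.obj (op (V a)) := fun a ↦ match a with
      | none => 0
      | some i => F.obj.map (homOfLE (inf_le_left : U i ⊓ W (fun j ↦ j ≠ i) ≤ U i)).op (s i)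
    have hcover : (⊤ : Opens X) ≤ iSup V := by
      intro x _
      rw [Opens.mem_iSup]
      by_cases h : ∃ i, x = p i
      · obtain ⟨i, rfl⟩ := h
        exact ⟨some i, hU i, (hW _ _).2 fun j hj h ↦ hj (hp h).symm⟩
      · exact ⟨none, (hW _ _).2 fun i _ h' ↦ h ⟨i, h'⟩⟩
    have hdisj : ∀ a b, a ≠ b → ∀ i, p i ∉ V a ⊓ V b := by
      have h1 : ∀ a i, p i ∈ V a → a = some i := by
        intro a i hi
        match a with
        | none => exact absurd rfl ((hW _ _).1 hi i trivial)
        | some j =>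
          by_contra h
          exact (hW _ _).1 hi.2 i (fun h' ↦ h (by rw [h'])) rfl
      exact fun a b hab i hi ↦ hab ((h1 a i hi.1).trans (h1 b i hi.2).symm)
    obtain ⟨r, hr, -⟩ := TopCat.Sheaf.existsUnique_gluing' (C := ModuleCat.{0} ℂ) (X := X) F V ⊤
      (fun a ↦ homOfLE le_top) hcover t (fun a b ↦ by
        by_cases hab : a = b
        · subst hab
          rfl
        · exact section_eq_of_disjoint p F hF _ (hdisj a b hab) _ _)
    refine ⟨r, funext fun i ↦ ?_⟩
    have hmem : p i ∈ V (some i) := ⟨hU i, (hW _ _).2 fun j hj h ↦ hj (hp h).symm⟩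
    have h1 : TopCat.Presheaf.germ F.obj (V (some i)) (p i) hmem
        (F.obj.map (homOfLE le_top).op r) = TopCat.Presheaf.germ F.obj ⊤ (p i) trivial r :=
      TopCat.Presheaf.germ_res_apply F.obj (homOfLE le_top) (p i) hmem r
    rw [hr (some i)] at h1
    refine Eq.trans h1.symm ?_
    refine Eq.trans ?_ (hs i)
    exact TopCat.Presheaf.germ_res_apply F.obj (homOfLE inf_le_left) (p i) hmem (s i)

omit [Fintype ι] hp hclosed hF in
-- The constant sheaf represents global sections; the adjunction is rewritten as evaluation at `1`
-- to make the bijection visibly linear.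
lemma nonempty_constantSheaf_hom_equiv :
    Nonempty (((constantSheaf (Opens.grothendieckTopology X) (ModuleCat.{0} ℂ)).obj
      (ModuleCat.of ℂ ℂ) ⟶ F) ≃ₗ[ℂ] F.obj.obj (op ⊤)) := by
  let adj := constantSheafAdj (Opens.grothendieckTopology X) (ModuleCat.{0} ℂ)
    (T := (⊤ : Opens X)) Limits.isTerminalTop
  let u := adj.unit.app (ModuleCat.of ℂ ℂ)
  let Φ : ((constantSheaf (Opens.grothendieckTopology X) (ModuleCat.{0} ℂ)).obj
      (ModuleCat.of ℂ ℂ) ⟶ F) →ₗ[ℂ] F.obj.obj (op ⊤) :=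
    { toFun f := (f.hom.app (op ⊤)).hom (u.hom (1 : ℂ))
      map_add' f g := rfl
      map_smul' c f := rfl }
  have hΦ : ∀ f, Φ f = (adj.homEquiv _ _ f).hom (1 : ℂ) := fun f ↦ by
    rw [adj.homEquiv_unit]
    rfl
  refine ⟨LinearEquiv.ofBijective Φ ⟨fun f g h ↦ ?_, fun s ↦ ?_⟩⟩
  · rw [hΦ, hΦ] at h
    exact (adj.homEquiv _ _).injective (ModuleCat.hom_ext (LinearMap.ext_ring h))
  · refine ⟨(adj.homEquiv _ _).symm (ModuleCat.ofHom (LinearMap.toSpanSingleton ℂ _ s)), ?_⟩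
    rw [hΦ, Equiv.apply_symm_apply]
    exact one_smul ℂ s

lemma nonempty_constantSheaf_hom_equiv_stalks :
    Nonempty (((constantSheaf (Opens.grothendieckTopology X) (ModuleCat.{0} ℂ)).obj
      (ModuleCat.of ℂ ℂ) ⟶ F) ≃ₗ[ℂ] ∀ i, (sheafStalk (p i)).obj F) := by
  obtain ⟨e⟩ := nonempty_constantSheaf_hom_equiv F
  exact ⟨e ≪≫ₗ LinearEquiv.ofBijective _ (bijective_germsLinearMap p hp hclosed F hF)⟩

end FiniteSupport

end Skyscraper

end KoszulHyper

namespace KoszulHyper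

/-! ### Complexes with injective cohomology in the derived category -/

section InjectiveHomology

open Limits HomologicalComplex

variable {C : Type*} [Category* C] [Abelian C]

/-- Injectivity of `H^p` splits its inclusion into the cokernel of the incoming differential. The
composite `K^p → H^p` kills boundaries, so it is a map of complexes to the single complex, and it
induces an isomorphism on `H^p`. -/
lemma exists_quasiIsoAt_single_of_injective_homology (K : CochainComplex C ℤ) (p : ℤ)
    [Injective (K.homology p)] :
    ∃ f : K ⟶ (single C (ComplexShape.up ℤ) p).obj (K.homology p), QuasiIsoAt f p := by
  let r : K.opcycles p ⟶ K.homology p := Injective.factorThru (𝟙 _) (K.homologyι p)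
  have hr : K.homologyι p ≫ r = 𝟙 _ := Injective.comp_factorThru _ _
  let f : K ⟶ (single C (ComplexShape.up ℤ) p).obj (K.homology p) :=
    mkHomToSingle (K.pOpcycles p ≫ r) fun i _ ↦ by simp
  have hf : opcyclesMap f p ≫ (singleObjOpcyclesSelfIso (ComplexShape.up ℤ) p
      (K.homology p)).inv = r := by
    rw [← cancel_epi (K.pOpcycles p), p_opcyclesMap_assoc,
      pOpcycles_singleObjOpcyclesSelfIso_inv]
    simp [f]
  have : homologyMap f p ≫ (singleObjHomologySelfIso (ComplexShape.up ℤ) p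
      (K.homology p)).hom = 𝟙 _ := by
    rw [← hr, ← hf, ← homologyι_singleObjOpcyclesSelfIso_inv, homologyι_naturality_assoc]
  refine ⟨f, ?_⟩
  rw [quasiIsoAt_iff_isIso_homologyMap]
  have h : homologyMap f p = (singleObjHomologySelfIso (ComplexShape.up ℤ) p
      (K.homology p)).inv := by
    rw [← cancel_mono (singleObjHomologySelfIso (ComplexShape.up ℤ) p (K.homology p)).hom, this,
      Iso.inv_hom_id]
  rw [h]
  infer_instance

lemma isIso_homologyMap_biprod_fst (A B : CochainComplex C ℤ) (i : ℤ)
    (hB : IsZero (B.homology i)) : IsIso (homologyMap (biprod.fst : A ⊞ B ⟶ A) i) := by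
  refine ⟨homologyMap biprod.inl i, ?_, ?_⟩
  · rw [← homologyMap_comp, ← homologyMap_id]
    have : 𝟙 (A ⊞ B) = biprod.fst ≫ biprod.inl + biprod.snd ≫ biprod.inr := biprod.total.symm
    rw [this, homologyMap_add, homologyMap_comp biprod.snd, hB.eq_of_tgt (homologyMap biprod.snd i) 0,
      zero_comp, add_zero]
  · rw [← homologyMap_comp, biprod.inl_fst, homologyMap_id]

lemma isIso_homologyMap_biprod_snd (A B : CochainComplex C ℤ) (i : ℤ)
    (hA : IsZero (A.homology i)) : IsIso (homologyMap (biprod.snd : A ⊞ B ⟶ B) i) := by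
  refine ⟨homologyMap biprod.inr i, ?_, ?_⟩
  · rw [← homologyMap_comp, ← homologyMap_id]
    have : 𝟙 (A ⊞ B) = biprod.fst ≫ biprod.inl + biprod.snd ≫ biprod.inr := biprod.total.symm
    rw [this, homologyMap_add, homologyMap_comp biprod.fst, hA.eq_of_tgt (homologyMap biprod.fst i) 0,
      zero_comp, zero_add]
  · rw [← homologyMap_comp, biprod.inr_snd, homologyMap_id]

lemma isZero_homology_biprod (A B : CochainComplex C ℤ) (i : ℤ)
    (hA : IsZero (A.homology i)) (hB : IsZero (B.homology i)) :
    IsZero ((A ⊞ B).homology i) :=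
  have := isIso_homologyMap_biprod_fst A B i hB
  hA.of_iso (asIso (homologyMap (biprod.fst : A ⊞ B ⟶ A) i))

lemma exists_quasiIso_biprod_single (K : CochainComplex C ℤ) (p q : ℤ) (hpq : p ≠ q)
    [Injective (K.homology p)] [Injective (K.homology q)]
    (hK : ∀ i, i ≠ p → i ≠ q → IsZero (K.homology i)) :
    ∃ f : K ⟶ (single C (ComplexShape.up ℤ) p).obj (K.homology p) ⊞
      (single C (ComplexShape.up ℤ) q).obj (K.homology q), QuasiIso f := by
  obtain ⟨f, hf⟩ := exists_quasiIsoAt_single_of_injective_homology K p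
  obtain ⟨g, hg⟩ := exists_quasiIsoAt_single_of_injective_homology K q
  rw [quasiIsoAt_iff_isIso_homologyMap] at hf hg
  refine ⟨biprod.lift f g, ⟨fun i ↦ ?_⟩⟩
  rw [quasiIsoAt_iff_isIso_homologyMap]
  by_cases hp : i = p
  · subst hp
    have := isIso_homologyMap_biprod_fst
      ((single C (ComplexShape.up ℤ) i).obj (K.homology i))
      ((single C (ComplexShape.up ℤ) q).obj (K.homology q)) i
      (isZero_single_obj_homology _ _ _ _ hpq)
    rw [← isIso_comp_right_iff _ (homologyMap biprod.fst i), ← homologyMap_comp, biprod.lift_fst]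
    exact hf
  by_cases hq : i = q
  · subst hq
    have := isIso_homologyMap_biprod_snd
      ((single C (ComplexShape.up ℤ) p).obj (K.homology p))
      ((single C (ComplexShape.up ℤ) i).obj (K.homology i)) i
      (isZero_single_obj_homology _ _ _ _ hp)
    rw [← isIso_comp_right_iff _ (homologyMap biprod.snd i), ← homologyMap_comp, biprod.lift_snd]
    exact hg
  · exact (hK i hp hq).isIso (isZero_homology_biprod _ _ _
      (isZero_single_obj_homology _ _ _ _ hp) (isZero_single_obj_homology _ _ _ _ hq)) _

lemma isKInjective_single (I : C) [Injective I] (p : ℤ) :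
    ((CochainComplex.singleFunctor C p).obj I).IsKInjective := by
  have : ∀ i, Injective (((CochainComplex.singleFunctor C p).obj I).X i) := fun i ↦ by
    by_cases hi : i = p
    · subst hi
      exact Injective.of_iso (singleObjXSelf (ComplexShape.up ℤ) i I).symm inferInstance
    · exact Injective.of_iso
        (isZero_single_obj_X (ComplexShape.up ℤ) p I i hi).isoZero.symm inferInstance
  have : ((CochainComplex.singleFunctor C p).obj I).IsStrictlyGE p := by
    dsimp [CochainComplex.singleFunctor, CochainComplex.singleFunctors]
    infer_instance
  exact CochainComplex.isKInjective_of_injective _ p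

variable [HasDerivedCategory C]

/-- Morphisms in the derived category into a K-injective complex are homotopy classes of chain maps,
and chain maps between complexes concentrated in different degrees are zero. -/
lemma subsingleton_single_hom_single_of_injective (A I : C) [Injective I] (p : ℤ) (hp : p ≠ 0) :
    Subsingleton ((DerivedCategory.singleFunctor C 0).obj A ⟶
      (DerivedCategory.singleFunctor C p).obj I) := by
  have := isKInjective_single I p
  have hb := CochainComplex.IsKInjective.Qh_map_bijective
    ((HomotopyCategory.quotient _ _).obj ((CochainComplex.singleFunctor C 0).obj A))
    ((CochainComplex.singleFunctor C p).obj I)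
  refine ⟨fun a b ↦ ?_⟩
  obtain ⟨a, rfl⟩ := hb.2 a
  obtain ⟨b, rfl⟩ := hb.2 b
  obtain ⟨a, rfl⟩ := (HomotopyCategory.quotient _ _).map_surjective a
  obtain ⟨b, rfl⟩ := (HomotopyCategory.quotient _ _).map_surjective b
  congr 2
  ext i
  by_cases hi : i = p
  · exact (isZero_single_obj_X (ComplexShape.up ℤ) 0 A i (by lia)).eq_of_src _ _
  · exact (isZero_single_obj_X (ComplexShape.up ℤ) p I i hi).eq_of_tgt _ _

lemma subsingleton_single_hom_shift_of_injective (A I : C) [Injective I] (p i : ℤ) (hp : i ≠ p) :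
    Subsingleton ((DerivedCategory.singleFunctor C 0).obj A ⟶
      ((DerivedCategory.singleFunctor C p).obj I)⟦i⟧) :=
  have := subsingleton_single_hom_single_of_injective A I (p - i) (by lia)
  (((DerivedCategory.singleFunctors C).shiftIso i (p - i) p (by lia)).app I).homToEquiv.subsingleton

variable [Linear ℂ C]

lemma nonempty_single_hom_shift_equiv (A I : C) (p : ℤ) :
    Nonempty (((DerivedCategory.singleFunctor C 0).obj A ⟶
      ((DerivedCategory.singleFunctor C p).obj I)⟦p⟧) ≃ₗ[ℂ] (A ⟶ I)) := by
  let e := ((DerivedCategory.singleFunctors C).shiftIso p 0 p (by lia)).app I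
  let e₁ : ((DerivedCategory.singleFunctor C 0).obj A ⟶
      ((DerivedCategory.singleFunctor C p).obj I)⟦p⟧) ≃ₗ[ℂ]
      ((DerivedCategory.singleFunctor C 0).obj A ⟶ (DerivedCategory.singleFunctor C 0).obj I) :=
    Linear.homCongr ℂ (Iso.refl _) e
  let e₂ : (A ⟶ I) ≃ₗ[ℂ]
      ((DerivedCategory.singleFunctor C 0).obj A ⟶ (DerivedCategory.singleFunctor C 0).obj I) :=
    LinearEquiv.ofBijective ((DerivedCategory.singleFunctor C 0).mapLinearMap ℂ)
      ⟨(DerivedCategory.singleFunctor C 0).map_injective,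
        (DerivedCategory.singleFunctor C 0).map_surjective⟩
  exact ⟨e₁.trans e₂.symm⟩

/-- Morphisms into the shift of a biproduct. -/
noncomputable def homShiftBiprodEquiv (Y : DerivedCategory C) (A B : CochainComplex C ℤ) (i : ℤ) :
    (Y ⟶ (DerivedCategory.Q.obj (A ⊞ B))⟦i⟧) ≃ₗ[ℂ]
      (Y ⟶ (DerivedCategory.Q.obj A)⟦i⟧) × (Y ⟶ (DerivedCategory.Q.obj B)⟦i⟧) :=
  LinearEquiv.ofLinearMap
    (((Linear.rightComp ℂ Y ((DerivedCategory.Q.map biprod.fst)⟦i⟧')).prod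
      (Linear.rightComp ℂ Y ((DerivedCategory.Q.map biprod.snd)⟦i⟧'))))
    (((Linear.rightComp ℂ Y ((DerivedCategory.Q.map biprod.inl)⟦i⟧')).coprod
      (Linear.rightComp ℂ Y ((DerivedCategory.Q.map biprod.inr)⟦i⟧'))))
    (by
      ext x <;> simp [← Functor.map_comp])
    (by
      ext x
      change (x ≫ (DerivedCategory.Q.map biprod.fst)⟦i⟧') ≫ (DerivedCategory.Q.map biprod.inl)⟦i⟧' +
        (x ≫ (DerivedCategory.Q.map biprod.snd)⟦i⟧') ≫ (DerivedCategory.Q.map biprod.inr)⟦i⟧' = x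
      simp only [Category.assoc, ← Functor.map_comp, ← Preadditive.comp_add, ← Functor.map_add]
      rw [biprod.total, CategoryTheory.Functor.map_id, CategoryTheory.Functor.map_id, Category.comp_id])

/-- The complex splits as `H^p[-p] ⊕ H^q[-q]`. In each degree at most one summand contributes, and
it contributes an ordinary Hom. -/
theorem hom_shift_of_injective_homology (A : C) (K : CochainComplex C ℤ) (p q : ℤ) (hpq : p ≠ q)
    [Injective (K.homology p)] [Injective (K.homology q)]
    (hK : ∀ i, i ≠ p → i ≠ q → IsZero (K.homology i)) :
    (∀ i, i ≠ p → i ≠ q → Subsingleton ((DerivedCategory.singleFunctor C 0).obj A ⟶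
      (DerivedCategory.Q.obj K)⟦i⟧)) ∧
    Nonempty (((DerivedCategory.singleFunctor C 0).obj A ⟶ (DerivedCategory.Q.obj K)⟦p⟧) ≃ₗ[ℂ]
      (A ⟶ K.homology p)) ∧
    Nonempty (((DerivedCategory.singleFunctor C 0).obj A ⟶ (DerivedCategory.Q.obj K)⟦q⟧) ≃ₗ[ℂ]
      (A ⟶ K.homology q)) := by
  obtain ⟨f, hf⟩ := exists_quasiIso_biprod_single K p q hpq hK
  let e (i : ℤ) : ((DerivedCategory.singleFunctor C 0).obj A ⟶ (DerivedCategory.Q.obj K)⟦i⟧) ≃ₗ[ℂ]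
      ((DerivedCategory.singleFunctor C 0).obj A ⟶
        ((DerivedCategory.singleFunctor C p).obj (K.homology p))⟦i⟧) ×
      ((DerivedCategory.singleFunctor C 0).obj A ⟶
        ((DerivedCategory.singleFunctor C q).obj (K.homology q))⟦i⟧) :=
    (Linear.homCongr ℂ (Iso.refl _) ((shiftFunctor _ i).mapIso
      (asIso (DerivedCategory.Q.map f)))).trans (homShiftBiprodEquiv _ _ _ i)
  refine ⟨fun i hp hq ↦ ?_, ?_, ?_⟩
  · have := subsingleton_single_hom_shift_of_injective A (K.homology p) p i hp
    have := subsingleton_single_hom_shift_of_injective A (K.homology q) q i hq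
    exact (e i).toEquiv.subsingleton
  · have := subsingleton_single_hom_shift_of_injective A (K.homology q) q p hpq
    obtain ⟨e'⟩ := nonempty_single_hom_shift_equiv A (K.homology p) p
    let _ : Unique ((DerivedCategory.singleFunctor C 0).obj A ⟶
        ((DerivedCategory.singleFunctor C q).obj (K.homology q))⟦p⟧) :=
      uniqueOfSubsingleton 0
    exact ⟨((e p).trans LinearEquiv.prodUnique).trans e'⟩
  · have := subsingleton_single_hom_shift_of_injective A (K.homology p) p q hpq.symm
    obtain ⟨e'⟩ := nonempty_single_hom_shift_equiv A (K.homology q) q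
    let _ : Unique ((DerivedCategory.singleFunctor C 0).obj A ⟶
        ((DerivedCategory.singleFunctor C p).obj (K.homology p))⟦q⟧) :=
      uniqueOfSubsingleton 0
    exact ⟨((e q).trans LinearEquiv.uniqueProd).trans e'⟩

end InjectiveHomology

end KoszulHyper

namespace KoszulHyper

/-! ### Hypercohomology of a locally trivialized Koszul complex -/

section KoszulHypercohomology

variable {X : TopCat.{0}} {G : Type} [AddCommGroup G] [Module ℂ G]
  {F : ℕ → TopCat.Presheaf (ModuleCat.{0} ℂ) X}

/-- Identifications of the stalks at `x` of sheaves `F j` with `R`, for which the action of `G` is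
given by multiplication by elements of `R`. -/
structure KoszulTrivialization (μ : ∀ j U, G →ₗ[ℂ] (F (j + 1)).obj U →ₗ[ℂ] (F j).obj U) (x : X)
    (R : Type) [CommRing R] [Algebra ℂ R] where
  triv : ∀ j, StalkTrivialization (F j) x R
  coeff : G →ₗ[ℂ] R
  coord_mul : ∀ (j : ℕ) (U : Opens X) (hx : x ∈ U) (g : G) (s : (F (j + 1)).obj (op U)),
    (triv j).coord U hx (μ j (op U) g s) = coeff g * (triv (j + 1)).coord U hx s

variable [FiniteDimensional ℂ G]
  (hF : ∀ j, (tensorPresheaf (F j) (⋀[ℂ]^j G)).IsSheaf)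
  (μ : ∀ j U, G →ₗ[ℂ] (F (j + 1)).obj U →ₗ[ℂ] (F j).obj U)
  (hμ : ∀ j {U U'} (f : U ⟶ U') (g : G) (s : (F (j + 1)).obj U),
    ((F j).map f).hom (μ j U g s) = μ j U' g (((F (j + 1)).map f).hom s))
  (hμ' : ∀ j U g g' s, μ j U g (μ (j + 1) U g' s) = μ j U g' (μ (j + 1) U g s))

/-- The Koszul complex `⋯ → F_2 ⊗ Λ² G → F_1 ⊗ G → F_0` of sheaves. -/
noncomputable abbrev koszulChainComplex :
    ChainComplex (Sheaf (Opens.grothendieckTopology X) (ModuleCat.{0} ℂ)) ℕ :=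
  tensorChainComplex F hF (fun j ↦ koszulPresheafHom (μ j) (hμ j) j)
    fun j ↦ koszulPresheafHom_comp (μ (j + 1)) (hμ (j + 1)) (μ j) (hμ j) (hμ' j) j

/-- The Koszul complex of sheaves as a cochain complex, with `F_0` in degree `dim G`. -/
noncomputable abbrev koszulCochainComplex :
    CochainComplex (Sheaf (Opens.grothendieckTopology X) (ModuleCat.{0} ℂ)) ℤ :=
  (koszulChainComplex hF μ hμ hμ').extend
    (ComplexShape.embeddingUpIntLE (Module.finrank ℂ G))

omit [FiniteDimensional ℂ G] in
lemma koszulCochainComplex_homology_iso (j : ℕ) (i : ℤ) (h : Module.finrank ℂ G - j = i) :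
    Nonempty ((koszulCochainComplex hF μ hμ hμ').homology i ≅
      (koszulChainComplex hF μ hμ hμ').homology j) :=
  ⟨HomologicalComplex.extendHomologyIso _ _ h⟩

theorem hom_koszulCochainComplex {ι : Type} [Fintype ι] (p : ι → X) (hp : Function.Injective p)
    (hclosed : ∀ i, IsClosed ({p i} : Set X))
    (S : X → Type) [∀ x, CommRing (S x)] [∀ x, Algebra ℂ (S x)]
    (c : ∀ x, KoszulTrivialization μ x (S x))
    (hout : ∀ x, x ∉ Set.range p → Ideal.span (Set.range (c x).coeff) = ⊤)
    (rs : ∀ i, List (S (p i)))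
    (hreg : ∀ i, RingTheory.Sequence.IsWeaklyRegular (S (p i)) (rs i))
    (hrs : ∀ i, Ideal.span (Set.range (c (p i)).coeff) = Ideal.ofList (rs i))
    (hlen : ∀ i, 1 + (rs i).length = Module.finrank ℂ G)
    [HasDerivedCategory (Sheaf (Opens.grothendieckTopology X) (ModuleCat.{0} ℂ))]
    (q r : ℤ) (hqr : q + 1 = r) (hr : Module.finrank ℂ G = r) :
    let H (i : ℤ) := (DerivedCategory.singleFunctor _ 0).obj
      ((constantSheaf (Opens.grothendieckTopology X) (ModuleCat.{0} ℂ)).obj (ModuleCat.of ℂ ℂ)) ⟶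
      (DerivedCategory.Q.obj (koszulCochainComplex hF μ hμ hμ'))⟦i⟧
    (∀ i : ℤ, i ≠ q → i ≠ r → Subsingleton (H i)) ∧
    Nonempty (H r ≃ₗ[ℂ] ∀ i, S (p i) ⧸ Ideal.ofList (rs i)) ∧
    Nonempty (H q ≃ₗ[ℂ] ∀ i, S (p i) ⧸ Ideal.ofList (rs i)) := by
  intro H
  obtain rfl : q = r - 1 := by lia
  let K := koszulCochainComplex hF μ hμ hμ'
  have hc (x : X) := fun j y ↦ ((c x).triv (j + 1)).tensorEquiv_koszulPresheafHom
    ((c x).triv j) (μ j) (hμ j) (c x).coeff ((c x).coord_mul j) j y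
  have hzero : ∀ x, x ∉ Set.range p → ∀ j, Limits.IsZero ((sheafStalk x).obj
      ((koszulChainComplex hF μ hμ hμ').homology j)) := fun x hx j ↦
    isZero_stalk_homology_of_span_eq_top F hF _ _ (c x).coeff (c x).triv (hc x) (hout x hx) j
  have hK : ∀ i : ℤ, i ≠ r - 1 → i ≠ r → Limits.IsZero (K.homology i) := by
    intro i h1 h2
    by_cases hi : i ≤ r
    -- Cohomological degree `i < r - 1` is homological degree `j + 2`. Negative `i` are included;
    -- the Koszul terms there vanish.
    · obtain ⟨j, hj⟩ : ∃ j : ℕ, r - (j + 2 : ℕ) = i := ⟨(r - 2 - i).toNat, by lia⟩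
      obtain ⟨e⟩ := koszulCochainComplex_homology_iso hF μ hμ hμ' (j + 2) i (hr ▸ hj)
      refine Limits.IsZero.of_iso ?_ e
      rw [isZero_iff_sheafStalk]
      intro x
      by_cases hx : x ∈ Set.range p
      · obtain ⟨k, rfl⟩ := hx
        refine isZero_stalk_homology_of_isWeaklyRegular F hF _ _ (c (p k)).coeff (c (p k)).triv
          (hc (p k)) (rs := rs k) (fun s hs ↦ ?_) (hreg k) (j + 1) ?_
        · rw [hrs k]
          exact Ideal.subset_span hs
        · have := hlen k
          omega
      · exact hzero x hx _
    · refine ((HomologicalComplex.exactAt_iff_isZero_homology _ _).1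
        (HomologicalComplex.extend_exactAt _ _ i fun j ↦ ?_))
      change (Module.finrank ℂ G : ℤ) - j ≠ i
      lia
  obtain ⟨e0⟩ := koszulCochainComplex_homology_iso hF μ hμ hμ' 0 r (by simp [hr])
  obtain ⟨e1⟩ := koszulCochainComplex_homology_iso hF μ hμ hμ' 1 (r - 1) (by simp [hr])
  have hz0 : ∀ x, x ∉ Set.range p → Limits.IsZero ((sheafStalk x).obj (K.homology r)) :=
    fun x hx ↦ (hzero x hx 0).of_iso ((sheafStalk x).mapIso e0)
  have hz1 : ∀ x, x ∉ Set.range p → Limits.IsZero ((sheafStalk x).obj (K.homology (r - 1))) :=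
    fun x hx ↦ (hzero x hx 1).of_iso ((sheafStalk x).mapIso e1)
  have i0 := injective_of_finite_support p hp hclosed _ hz0
  have i1 := injective_of_finite_support p hp hclosed _ hz1
  obtain ⟨hs, ⟨f1⟩, ⟨f0⟩⟩ := hom_shift_of_injective_homology
    ((constantSheaf (Opens.grothendieckTopology X) (ModuleCat.{0} ℂ)).obj (ModuleCat.of ℂ ℂ))
    K (r - 1) r (by lia) hK
  obtain ⟨g0⟩ := nonempty_constantSheaf_hom_equiv_stalks p hp hclosed _ hz0
  obtain ⟨g1⟩ := nonempty_constantSheaf_hom_equiv_stalks p hp hclosed _ hz1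
  have hst := fun k ↦ nonempty_stalk_homology_equiv_quotient F hF _
    (fun j ↦ koszulPresheafHom_comp (μ (j + 1)) (hμ (j + 1)) (μ j) (hμ j) (hμ' j) j) (c (p k)).coeff
    (c (p k)).triv (hc (p k)) (hrs k) (hreg k) (hlen k)
  refine ⟨hs, ⟨(f0 ≪≫ₗ g0) ≪≫ₗ LinearEquiv.piCongrRight fun k ↦ ?_⟩,
    ⟨(f1 ≪≫ₗ g1) ≪≫ₗ LinearEquiv.piCongrRight fun k ↦ ?_⟩⟩
  · exact ((sheafStalk (p k)).mapIso e0).toLinearEquiv ≪≫ₗ (hst k).1.some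
  · exact ((sheafStalk (p k)).mapIso e1).toLinearEquiv ≪≫ₗ (hst k).2.some

end KoszulHypercohomology

end KoszulHyper

namespace KoszulHyper

/-! ### Local rings of the zero scheme and the theorem -/

section StalkQuotient

variable {Z X : Scheme.{0}} [Z.Over SpecC] [X.Over SpecC]

lemma stalkMap_algebraMap (f : Z ⟶ X) (hf : f ≫ (X ↘ SpecC) = Z ↘ SpecC) (z : Z) (a : ℂ) :
    (f.stalkMap z).hom (algebraMap ℂ (X.presheaf.stalk (f z)) a) =
      algebraMap ℂ (Z.presheaf.stalk z) a := by
  change (f.stalkMap z).hom ((X.presheaf.germ ⊤ (f z) trivial).hom (constMap X ⊤ a)) =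
    (Z.presheaf.germ ⊤ z trivial).hom (constMap Z ⊤ a)
  refine (Scheme.Hom.germ_stalkMap_apply f ⊤ z trivial _).trans ?_
  congr 1
  have h : f.app ⊤ (constMap X ⊤ a) = constMap Z ⊤ a := by
    change ((Scheme.ΓSpecIso (CommRingCat.of ℂ)).inv ≫ ((X ↘ SpecC).appTop ≫
      X.presheaf.map (homOfLE (le_top : (⊤ : X.Opens) ≤ ⊤)).op) ≫ f.app ⊤).hom a =
      ((Scheme.ΓSpecIso (CommRingCat.of ℂ)).inv ≫ ((Z ↘ SpecC).appTop ≫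
      Z.presheaf.map (homOfLE (le_top : (⊤ : Z.Opens) ≤ ⊤)).op)).hom a
    have h1 : X.presheaf.map (homOfLE (le_top : (⊤ : X.Opens) ≤ ⊤)).op = 𝟙 _ := X.presheaf.map_id _
    have h2 : Z.presheaf.map (homOfLE (le_top : (⊤ : Z.Opens) ≤ ⊤)).op = 𝟙 _ := Z.presheaf.map_id _
    rw [h1, h2, Category.comp_id, Category.comp_id, ← hf]
    rfl
  exact h

/-- A closed immersion is surjective on stalks. Compatibility with the structure maps to `Spec ℂ`
makes the resulting isomorphism `ℂ`-linear. -/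
lemma nonempty_stalk_quotient_equiv (f : Z ⟶ X) [IsClosedImmersion f]
    (hf : f ≫ (X ↘ SpecC) = Z ↘ SpecC) (z : Z) (I : Ideal (X.presheaf.stalk (f z)))
    (hI : RingHom.ker (f.stalkMap z).hom = I) :
    Nonempty ((X.presheaf.stalk (f z) ⧸ I) ≃ₗ[ℂ] Z.presheaf.stalk z) := by
  subst hI
  let φ : X.presheaf.stalk (f z) →ₐ[ℂ] Z.presheaf.stalk z :=
    { (f.stalkMap z).hom with commutes' := stalkMap_algebraMap f hf z }
  exact ⟨(Ideal.quotientKerAlgEquivOfSurjective (f := φ)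
    (f.stalkMap_surjective z)).toLinearEquiv⟩

end StalkQuotient

section ArtinianStalk

lemma isArtinianRing_stalk {Z : Scheme.{0}} [IsLocallyArtinian Z] (z : Z) :
    IsArtinianRing (Z.presheaf.stalk z) := by
  obtain ⟨V, hV, hz, -⟩ := exists_isAffineOpen_mem_and_subset (X := Z) (x := z) (U := ⊤) trivial
  have : IsArtinianRing Γ(Z, V) := IsLocallyArtinian.isArtinianRing_presheaf_obj (X := Z) ⟨V, hV⟩
  let := Z.presheaf.algebra_section_stalk (⟨z, hz⟩ : V)
  have := hV.isLocalization_stalk ⟨z, hz⟩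
  exact IsArtinianRing.localization_artinian (hV.primeIdealOf ⟨z, hz⟩).asIdeal.primeCompl _

end ArtinianStalk

section Main

variable {X : Scheme.{0}} [X.Over SpecC] {L : X.Modules} {D : ℕ}
  (G : Submodule ℂ (powSections L D ⊤)) (m : ℤ)

lemma koszul_degree (j : ℕ) : m - (j + 1 : ℕ) * D + D = m - j * D := by
  push_cast
  ring

/-- The trivialization of the Koszul complex of `G` at `x` defined by a frame of `L`. -/
noncomputable def powKoszulTrivialization {V : X.Opens} (e : Frame L V) (x : X) (hxV : x ∈ V) :
    @KoszulTrivialization X.toTopCat G G.addCommGroup G.module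
      (fun j ↦ powPresheaf L (m - j * D)) (fun j ↦ koszulMul G (koszul_degree m j)) x
      (X.presheaf.stalk x) _ _ :=
  @KoszulTrivialization.mk X.toTopCat G G.addCommGroup G.module
    (fun j ↦ powPresheaf L (m - j * D)) (fun j ↦ koszulMul G (koszul_degree m j)) x
    (X.presheaf.stalk x) _ _
    (fun j ↦ powTrivialization (m - j * D) e x hxV) (coordMap G e x hxV)
    fun j U hx g s ↦ powTrivialization_koszulMul G (koszul_degree m j) e x hxV U hx g s


lemma span_range_coordMap_eq (V : X.affineOpens) (e : Frame L V.1)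
    (he : (generatedIdeal L D G).ideal V = frameIdeal L D G e) (x : X) (hxV : x ∈ V.1) :
    Ideal.span (Set.range (coordMap G e x hxV)) =
      ((generatedIdeal L D G).ideal V).map (X.presheaf.germ V.1 x hxV).hom := by
  rw [he]
  exact span_range_coordMap G e x hxV

end Main

end KoszulHyper

open KoszulHyper in
theorem mainTheorem7 (n : ℕ) (hn : 1 ≤ n)
    (X : Scheme.{0}) [X.Over KoszulHyper.SpecC] [ConnectedSpace X]
    (hproj : KoszulHyper.IsProjective X)
    [SmoothOfRelativeDimension (n + 1) (X ↘ KoszulHyper.SpecC)]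
    (L : X.Modules) (hL : KoszulHyper.IsInvertible L)
    (D : ℕ) (hD : 0 < D)
    (G : Submodule ℂ (KoszulHyper.powSections L D ⊤)) [FiniteDimensional ℂ G]
    (hG : Module.finrank ℂ G = n + 2)
    (hart : IsArtinianScheme (KoszulHyper.zeroScheme L D G))
    (hlci : KoszulHyper.IsLocalCompleteIntersection
      (KoszulHyper.generatedIdeal L D G).subschemeι)
    (m : ℤ) :
    (∀ i : ℤ, i ≠ n + 1 → i ≠ n + 2 →
      Subsingleton (KoszulHyper.Hypercohomology (KoszulHyper.koszulComplex L D G m) i)) ∧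
    Nonempty (KoszulHyper.Hypercohomology (KoszulHyper.koszulComplex L D G m) (n + 2) ≃ₗ[ℂ]
      DirectSum (KoszulHyper.zeroScheme L D G)
        fun P ↦ (KoszulHyper.zeroScheme L D G).presheaf.stalk P) ∧
    Nonempty (KoszulHyper.Hypercohomology (KoszulHyper.koszulComplex L D G m) (n + 1) ≃ₗ[ℂ]
      DirectSum (KoszulHyper.zeroScheme L D G)
        fun P ↦ (KoszulHyper.zeroScheme L D G).presheaf.stalk P) := by
  classical
  have := hproj.compactSpace
  have := isLocallyNoetherian_of_smoothOfRelativeDimension (X ↘ SpecC) (n + 1)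
  have : QuasiSeparatedSpace X := inferInstance
  have : Fintype (zeroScheme L D G) := Fintype.ofFinite _
  choose V e hxV hV using exists_generatedIdeal_eq L D G hL
  choose rs hreg hker using hlci
  let ι := (generatedIdeal L D G).subschemeι
  have hspan : ∀ x, Ideal.span (Set.range (coordMap G (e x) x (hxV x))) =
      ((generatedIdeal L D G).ideal (V x)).map (X.presheaf.germ (V x).1 x (hxV x)).hom :=
    fun x ↦ span_range_coordMap_eq G (V x) (e x) (hV x) x (hxV x)
  have hrs : ∀ z, Ideal.span (Set.range (coordMap G (e (ι z)) (ι z) (hxV (ι z)))) =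
      Ideal.ofList (rs z) := fun z ↦ by
    rw [hspan, ← hker, ker_stalkMap_subschemeι]
  -- An artinian scheme is discrete, so its points are closed, and a closed immersion keeps them
  -- closed.
  have hclosed : ∀ z, IsClosed ({ι z} : Set X) := fun z ↦ by
    have := ι.isClosedEmbedding.isClosedMap {z} (isClosed_discrete _)
    rwa [Set.image_singleton] at this
  have hq : ∀ z, Nonempty ((X.presheaf.stalk (ι z) ⧸ Ideal.ofList (rs z)) ≃ₗ[ℂ]
      (zeroScheme L D G).presheaf.stalk z) := fun z ↦
    nonempty_stalk_quotient_equiv ι rfl z _ (hker z)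
  -- The artinian quotient forces the regular sequence to have length `n + 1`, the dimension of the
  -- local ring; this is one less than `dim G`.
  have hlen : ∀ z, 1 + (rs z).length = Module.finrank ℂ G := fun z ↦ by
    have := isArtinianRing_stalk z
    have : IsArtinianRing (X.presheaf.stalk (ι z) ⧸ Ideal.ofList (rs z)) := by
      let e := (Ideal.quotEquivOfEq (hker z)).symm.trans
        (RingHom.quotientKerEquivOfSurjective (f := (ι.stalkMap z).hom) (ι.stalkMap_surjective z))
      exact e.symm.surjective.isArtinianRing
    have := length_eq_of_isRegular (ringKrullDim_stalk_of_smoothOfRelativeDimension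
      (X ↘ SpecC) (n + 1) (ι z) (hclosed z)) (hreg z)
    omega
  obtain ⟨h0, ⟨e2⟩, ⟨e1⟩⟩ := @hom_koszulCochainComplex X.toTopCat G G.addCommGroup G.module
    (fun j ↦ powPresheaf L (m - j * D)) _
    (fun _ ↦ tensorPresheaf_isSheaf _ (powPresheaf_isSheaf L _) _)
    (fun j ↦ koszulMul G (koszul_degree m j))
    (fun j ↦ koszulMul_res L D G (koszul_degree m j))
    (fun j ↦ koszulMul_comm L D G (koszul_degree m (j + 1)) (koszul_degree m j))
    (zeroScheme L D G) _ ι ι.isClosedEmbedding.injective hclosed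
    (fun x ↦ X.presheaf.stalk x) _ _
    (fun x ↦ powKoszulTrivialization G m (e x) x (hxV x))
    (fun x hx ↦ (hspan x).trans (map_germ_ideal_eq_top _ x hx (V x) (hxV x)))
    rs (fun z ↦ (hreg z).toIsWeaklyRegular) hrs hlen
    (hasDerivedCategorySheafC (X := X)) (n + 1) (n + 2) (by ring) (by rw [hG]; push_cast; rfl)
  -- The zero scheme is finite, so the product of its local rings is their direct sum.
  let E : (∀ z, X.presheaf.stalk (ι z) ⧸ Ideal.ofList (rs z)) ≃ₗ[ℂ]
      DirectSum (zeroScheme L D G) fun P ↦ (zeroScheme L D G).presheaf.stalk P :=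
    LinearEquiv.piCongrRight (fun z ↦ (hq z).some) ≪≫ₗ
      (DirectSum.linearEquivFunOnFintype ℂ _ _).symm
  refine ⟨fun i h1 h2 ↦ h0 i h1 h2, ⟨e2 ≪≫ₗ E⟩, ⟨e1 ≪≫ₗ E⟩⟩
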